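/- Let $\mathscr G\subset\mathbb R^d\rtimes O(d)$ be a $d$-dimensional crystallographic space group (a discrete cocompact subgroup of the Euclidean group, an origin being chosen), with lattice $\Pi=\mathscr G\cap\mathbb R^d$ and point group $G\subset O(d)$ (the image of $\mathscr G$ in $O(d)$). Choose for every $g\in G$ a lift $(\tilde s(g),g)\in\mathscr G$. Let $G$ act on $\mathbb T^d=\mathbb R^d/\Pi$ by $g\cdot[x]=[\tilde s(g)+gx]$ and on $\hat\Pi=\mathrm{Hom}(\Pi,U(1))$ by $(g\cdot\chi)(n)=\chi(g^{-1}n)$. Put $$\nu(g,h)=\tilde s(g)+g\,\tilde s(h)-\tilde s(gh)\in\Pi,\qquad \tau_{\mathscr G}(g,h)(\chi)=(gh\cdot\chi)(\nu(g,h))\in U(1),$$ a $2$-cocycle of $G$ with values in $C(\hat\Pi,U(1))$, that is, $\tau(h,k)(\chi)\,\tau(g,hk)(\chi)=\tau(gh,k)(\chi)\,\tau(g,h)(k\cdot\chi)$, and let $\hat p:\mathbb T^d\times\hat\Pi\to\hat\Pi$ be the projection. Let $\mathcal P\to\mathbb T^d\times\hat\Pi$ be the Poincaré line bundle, the quotient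 of $\mathbb R^d\times\hat\Pi\times\mathbb C$ by the action $n:(x,\chi,z)\mapsto(x+n,\chi,\chi(n)z)$ of $\Pi$, with the maps $\gamma(g)[x,\chi,z]=[\tilde s(g)+gx,\,g\cdot\chi,\,z]$, and let $\mathcal P^*$ be the dual line bundle with the maps $\gamma^*(g)\xi=\xi\circ\gamma(g)^{-1}$. Then $\mathcal P^*$ trivialises $\hat p^*\tau_{\mathscr G}$ as a twist in $H^3_G(\mathbb T^d\times\hat\Pi,\mathbb Z)$. That is: $\mathcal P^*$ with the maps $\gamma^*(g)$ is a $\hat p^*\tau_{\mathscr G}$-twisted $G$-equivariant complex line bundle (the $\gamma^*(g)$ are bundle isomorphisms covering the diagonal action of $G$ on $\mathbb T^d\times\hat\Pi$, and $\gamma^*(g)\gamma^*(h)=\hat p^*\tau_{\mathscr G}(g,h)\,\gamma^*(gh)$, the function being evaluated at the base point of the vector acted upon), and the class of $\hat p^*\tau_{\mathscr G}$ in the Borel equivariant cohomology group $H^3_G(\mathbb T^d\times\hat\Pi,\mathbb Z)$ is zero. -/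

import Mathlib

noncomputable section

namespace CrystalTDuality

/-! ## Singular lifting of phases -/

/-- A singular `q`-simplex of `X`. -/
abbrev Simplex (q : ℕ) (X : Type*) [TopologicalSpace X] := C(stdSimplex ℝ (Fin (q + 1)), X)

/-- The inclusion of the `i`-th face of the standard `(q + 1)`-simplex. -/
def faceInclusion (q : ℕ) (i : Fin (q + 2)) :
    C(stdSimplex ℝ (Fin (q + 1)), stdSimplex ℝ (Fin (q + 2))) :=
  ⟨stdSimplex.map i.succAbove, stdSimplex.continuous_map _⟩

instance (n : ℕ) : SimplyConnectedSpace (stdSimplex ℝ (Fin (n + 1))) := by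
  have : ContractibleSpace (stdSimplex ℝ (Fin (n + 1))) :=
    (convex_stdSimplex ℝ (Fin (n + 1))).contractibleSpace ⟨_, single_mem_stdSimplex ℝ 0⟩
  infer_instance

instance (n : ℕ) : LocallyPathConnectedSpace (stdSimplex ℝ (Fin (n + 1))) :=
  (convex_stdSimplex ℝ (Fin (n + 1))).locallyPathConnectedSpace

/-- Every circle valued function on a simplex is `exp (i F)` for a continuous real `F`. -/
theorem exists_lift {q : ℕ} (f : Simplex q Circle) :
    ∃ F : C(stdSimplex ℝ (Fin (q + 1)), ℝ), ∀ t, Circle.exp (F t) = f t := by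
  obtain ⟨e, he⟩ := Circle.exp_surjective (f (stdSimplex.vertex 0))
  obtain ⟨F, hF, -⟩ := Circle.isCoveringMap_exp.existsUnique_continuousMap_lifts f
    (stdSimplex.vertex 0) e he
  exact ⟨F, fun t => congrFun hF.2 t⟩

/-- Two continuous lifts of the same function differ by a constant. -/
theorem lift_unique {A : Type*} [TopologicalSpace A] [PreconnectedSpace A] (F F' : C(A, ℝ))
    (h : ∀ t, Circle.exp (F t) = Circle.exp (F' t)) (a b : A) :
    F b - F a = F' b - F' a := by
  have hcomp : Circle.exp ∘ (fun t => F t - F a + F' a) = Circle.exp ∘ F' := by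
    funext t
    simp [Circle.exp_add, Circle.exp_sub, h]
  have key := Circle.isCoveringMap_exp.eq_of_comp_eq (by fun_prop) F'.continuous hcomp a (by simp)
  have := congrFun key b
  linarith

/-- The total variation `F(v₁) - F(v₀)` of the phase of a circle valued function `exp (i F)` on a
`1`-simplex, where `F` is a continuous real lift. -/
def phaseVariation (f : Simplex 1 Circle) : ℝ :=
  (exists_lift f).choose (stdSimplex.vertex 1) - (exists_lift f).choose (stdSimplex.vertex 0)

theorem phaseVariation_eq (f : Simplex 1 Circle) (F : C(stdSimplex ℝ (Fin 2), ℝ))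
    (hF : ∀ t, Circle.exp (F t) = f t) :
    phaseVariation f = F (stdSimplex.vertex 1) - F (stdSimplex.vertex 0) :=
  lift_unique _ _ (fun t => by rw [(exists_lift f).choose_spec t, hF t]) _ _

theorem phaseVariation_mul (f f' : Simplex 1 Circle) :
    phaseVariation (f * f') = phaseVariation f + phaseVariation f' := by
  obtain ⟨F, hF⟩ := exists_lift f
  obtain ⟨F', hF'⟩ := exists_lift f'
  rw [phaseVariation_eq f F hF, phaseVariation_eq f' F' hF',
    phaseVariation_eq (f * f') (F + F') (fun t => by simp [Circle.exp_add, hF, hF'])]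
  simp only [ContinuousMap.add_apply]
  ring

theorem exp_phaseVariation (f : Simplex 1 Circle) :
    Circle.exp (phaseVariation f) * f (stdSimplex.vertex 0) = f (stdSimplex.vertex 1) := by
  obtain ⟨F, hF⟩ := exists_lift f
  rw [phaseVariation_eq f F hF, ← hF, ← hF, ← Circle.exp_add]
  congr 1
  ring

theorem faceInclusion_vertex (q : ℕ) (i : Fin (q + 2)) (j : Fin (q + 1)) :
    faceInclusion q i (stdSimplex.vertex j) = stdSimplex.vertex (i.succAbove j) := by
  simp [faceInclusion]

theorem phaseVariation_triangle (f : Simplex 2 Circle) :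
    phaseVariation (f.comp (faceInclusion 1 0)) - phaseVariation (f.comp (faceInclusion 1 1))
      + phaseVariation (f.comp (faceInclusion 1 2)) = 0 := by
  obtain ⟨F, hF⟩ := exists_lift f
  have key : ∀ i, phaseVariation (f.comp (faceInclusion 1 i)) =
      F (stdSimplex.vertex (i.succAbove 1)) - F (stdSimplex.vertex (i.succAbove 0)) := fun i => by
    rw [phaseVariation_eq _ (F.comp (faceInclusion 1 i)) (fun t => by simp [hF])]
    simp only [ContinuousMap.comp_apply, faceInclusion_vertex]
  rw [key, key, key]
  have e1 : (0 : Fin 3).succAbove (1 : Fin 2) = 2 := by decide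
  have e2 : (0 : Fin 3).succAbove (0 : Fin 2) = 1 := by decide
  have e3 : (1 : Fin 3).succAbove (1 : Fin 2) = 2 := by decide
  have e4 : (1 : Fin 3).succAbove (0 : Fin 2) = 0 := by decide
  have e5 : (2 : Fin 3).succAbove (1 : Fin 2) = 1 := by decide
  have e6 : (2 : Fin 3).succAbove (0 : Fin 2) = 0 := by decide
  rw [e1, e2, e3, e4, e5, e6]
  ring

/-! ## Borel equivariant cohomology

For a discrete group `G` acting on a space `X`, the Borel equivariant cohomology
`Hⁿ_G(X, ℤ) = Hⁿ(EG ×_G X, ℤ)` is the hypercohomology of `G` with coefficients in the singular cochain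
complex of `X`, i.e. the cohomology of the total complex of the double complex of group cochains
with values in singular cochains. In bidegree `(p, q)` this consists of the integral functions of
`(g₀, …, g_{p-1}; σ)`, for `gᵢ ∈ G` and `σ` a singular `q`-simplex of `X`: the singular `q`-cochains of
the `p`-th level `Gᵖ × X` of the nerve of the action groupoid `X // G`, where `(g₀, …, g_{p-1}; x)`
is the string of arrows which starts at `x` with `g_{p-1}` and ends with `g₀`. -/

section Equivariant

variable (G : Type*) [Group G] (X : Type*) [TopologicalSpace X] [MulAction G X]
  [ContinuousConstSMul G X]

/-- Translation of a singular simplex by a group element. -/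
def translateSimplex {G X : Type*} [Group G] [TopologicalSpace X] [MulAction G X]
    [ContinuousConstSMul G X] {q : ℕ} (g : G) (σ : Simplex q X) : Simplex q X :=
  ⟨fun t => g • σ t, σ.continuous.const_smul g⟩

/-- Cochains of bidegree `(p, q)`. -/
abbrev BiCochain (p q : ℕ) := (Fin p → G) → Simplex q X → ℤ

/-- The differential in the group direction, i.e. the alternating sum over the faces of the nerve:
omit `g₀`, multiply two neighbours, omit the last `g_p` and translate the simplex by it. -/
def dGroup (p q : ℕ) : BiCochain G X p q →+ BiCochain G X (p + 1) q where
  toFun c := fun g σ => c (fun j => g j.succ) σ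
    + ∑ j : Fin p, (-1) ^ (j.val + 1) * c (Fin.contractNth j.castSucc (· * ·) g) σ
    + (-1) ^ (p + 1) * c (fun j => g j.castSucc) (translateSimplex (g (Fin.last p)) σ)
  map_zero' := by funext g σ; simp
  map_add' c c' := by
    funext g σ
    simp only [Pi.add_apply, mul_add, Finset.sum_add_distrib]
    ring

/-- The singular differential, the alternating sum over the faces of the simplex. -/
def dSing (p q : ℕ) : BiCochain G X p q →+ BiCochain G X p (q + 1) where
  toFun c := fun g σ => ∑ i : Fin (q + 2), (-1) ^ i.val * c g (σ.comp (faceInclusion q i))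
  map_zero' := by funext g σ; simp
  map_add' c c' := by
    funext g σ
    simp only [Pi.add_apply, mul_add, Finset.sum_add_distrib]

/-- Families of cochains of all bidegrees. -/
abbrev Cochain := ∀ p q : ℕ, BiCochain G X p q

/-- The part of the total differential in the group direction. -/
def groupPart (c : Cochain G X) : Cochain G X
  | 0, _ => 0
  | p + 1, q => dGroup G X p q (c p q)

/-- The part of the total differential in the singular direction, with its sign. -/
def singPart (c : Cochain G X) : Cochain G X
  | _, 0 => 0
  | p, q + 1 => (-1) ^ p * dSing G X p q (c p q)

/-- The total differential: `dGroup + (-1)ᵖ dSing` on bidegree `(p, q)`. -/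
def totalD : Cochain G X →+ Cochain G X where
  toFun c := groupPart G X c + singPart G X c
  map_zero' := by
    funext p q
    rcases p with _ | p <;> rcases q with _ | q <;> simp [groupPart, singPart]
  map_add' c c' := by
    funext p q
    rcases p with _ | p <;> rcases q with _ | q <;>
      simp only [groupPart, singPart, Pi.add_apply, map_add, mul_add] <;> abel

/-- The cochains of total degree `n`, concentrated in the bidegrees with `p + q = n`. -/
def degreePart (n : ℕ) : AddSubgroup (Cochain G X) where
  carrier := {c | ∀ p q, p + q ≠ n → c p q = 0}
  zero_mem' := fun _ _ _ => rfl
  add_mem' := fun ha hb p q h => by simp [ha p q h, hb p q h]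
  neg_mem' := fun ha p q h => by simp [ha p q h]

/-- The `n`-cocycles of the total complex. -/
def cocycles (n : ℕ) : AddSubgroup (Cochain G X) := degreePart G X n ⊓ (totalD G X).ker

/-- The `n`-coboundaries of the total complex. -/
def coboundaries : ℕ → AddSubgroup (Cochain G X)
  | 0 => ⊥
  | n + 1 => (degreePart G X n).map (totalD G X)

/-- The Borel equivariant cohomology group `Hⁿ_G(X, ℤ)`. -/
def EquivariantCohomology (n : ℕ) : Type _ :=
  cocycles G X n ⧸ (coboundaries G X n).addSubgroupOf (cocycles G X n)

instance (n : ℕ) : AddCommGroup (EquivariantCohomology G X n) :=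
  inferInstanceAs (AddCommGroup
    (cocycles G X n ⧸ (coboundaries G X n).addSubgroupOf (cocycles G X n)))

end Equivariant

/-- `2`-cocycles of `G` with values in the unitary group `C(X, U(1))`, the value `τ(g, h)(x)` being
attached to the composable arrows `x → h x → g h x` of the action groupoid. -/
def IsTwistCocycle {G : Type*} [Group G] {X : Type*} [TopologicalSpace X] [MulAction G X]
    (τ : G → G → C(X, Circle)) : Prop :=
  ∀ g h k x, τ h k x * τ g (h * k) x = τ (g * h) k x * τ g h (k • x)

/-- If one lets `G` act on functions by `(g • f)(x) = f(g⁻¹ x)` and evaluates at the end point instead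
of the starting point, `τ'(g, h)(x) = τ(g, h)((g h)⁻¹ x)`, then this is the usual cocycle identity
`(g • τ'(h, k)) τ'(g, h k) = τ'(g h, k) τ'(g, h)`. -/
theorem isTwistCocycle_iff {G : Type*} [Group G] {X : Type*} [TopologicalSpace X] [MulAction G X]
    (τ : G → G → C(X, Circle)) (τ' : G → G → X → Circle)
    (hτ' : ∀ g h x, τ' g h x = τ g h ((g * h)⁻¹ • x)) :
    IsTwistCocycle τ ↔
      ∀ g h k x, τ' h k (g⁻¹ • x) * τ' g (h * k) x = τ' (g * h) k x * τ' g h x := by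
  simp only [hτ']
  constructor
  · intro H g h k x
    have := H g h k ((g * h * k)⁻¹ • x)
    simp only [smul_smul] at *
    simpa [mul_assoc] using this
  · intro H g h k x
    have := H g h k ((g * h * k) • x)
    simp only [smul_smul] at *
    simpa [mul_assoc] using this

section Twist

variable {G : Type*} [Group G] {X : Type*} [TopologicalSpace X] [MulAction G X]
  [ContinuousConstSMul G X]

/-- The phase `θ(g, h)(x) ∈ (-π, π]` of `τ(g, h)(x)`, a not necessarily continuous real lift of `τ`. -/
def angle {G X : Type*} [TopologicalSpace X] (τ : G → G → C(X, Circle)) (g h : G) (x : X) : ℝ := Complex.arg (τ g h x)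

theorem exp_angle {G X : Type*} [TopologicalSpace X] (τ : G → G → C(X, Circle)) (g h : G) (x : X) :
    Circle.exp (angle τ g h x) = τ g h x := Circle.exp_arg _

/-- The integral cochain of total degree `3` which represents the image of the cocycle `τ` under the
connecting map `H²(G, C(X, U(1))) → H³_G(X, ℤ)` of the exponential sequence: with `θ` a real lift of
`τ`, it is `(D θ - Δ) / 2π`, where `D` is the total differential and `Δ` is the real cochain of
bidegree `(2, 1)` which takes `(g, h; σ)` to the total variation of the phase of the continuous function
`τ(g, h)` along the path `σ`. The rounded numbers are integers. -/
def twistCochain (τ : G → G → C(X, Circle)) : Cochain G X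
  | 3, 0 => fun g σ =>
      let x := σ (stdSimplex.vertex 0)
      round ((angle τ (g 1) (g 2) x - angle τ (g 0 * g 1) (g 2) x + angle τ (g 0) (g 1 * g 2) x
        - angle τ (g 0) (g 1) (g 2 • x)) / (2 * Real.pi))
  | 2, 1 => fun g σ =>
      round ((angle τ (g 0) (g 1) (σ (stdSimplex.vertex 1))
        - angle τ (g 0) (g 1) (σ (stdSimplex.vertex 0))
        - phaseVariation ((τ (g 0) (g 1)).comp σ)) / (2 * Real.pi))
  | _, _ => 0

theorem round_eq_of_exp {r : ℝ} (h : Circle.exp r = 1) :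
    (round (r / (2 * Real.pi)) : ℝ) * (2 * Real.pi) = r := by
  obtain ⟨n, hn⟩ := Circle.exp_eq_one.1 h
  have h2 : (2 * Real.pi) ≠ 0 := by positivity
  rw [hn, mul_div_cancel_right₀ _ h2, round_intCast]

theorem twistCochain_30 {τ : G → G → C(X, Circle)} (hτ : IsTwistCocycle τ) (g : Fin 3 → G)
    (σ : Simplex 0 X) : (twistCochain τ 3 0 g σ : ℝ) * (2 * Real.pi) =
      angle τ (g 1) (g 2) (σ (stdSimplex.vertex 0))
        - angle τ (g 0 * g 1) (g 2) (σ (stdSimplex.vertex 0))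
        + angle τ (g 0) (g 1 * g 2) (σ (stdSimplex.vertex 0))
        - angle τ (g 0) (g 1) (g 2 • (σ (stdSimplex.vertex 0))) := by
  apply round_eq_of_exp
  have := hτ (g 0) (g 1) (g 2) (σ (stdSimplex.vertex 0))
  simp only [Circle.exp_add, Circle.exp_sub, exp_angle]
  rw [div_mul_eq_mul_div, this, mul_comm]
  simp

theorem twistCochain_21 (τ : G → G → C(X, Circle)) (g : Fin 2 → G)
    (σ : Simplex 1 X) : (twistCochain τ 2 1 g σ : ℝ) * (2 * Real.pi) =
      angle τ (g 0) (g 1) (σ (stdSimplex.vertex 1))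
        - angle τ (g 0) (g 1) (σ (stdSimplex.vertex 0))
        - phaseVariation ((τ (g 0) (g 1)).comp σ) := by
  apply round_eq_of_exp
  have := exp_phaseVariation ((τ (g 0) (g 1)).comp σ)
  simp only [Circle.exp_sub, exp_angle]
  simp only [ContinuousMap.comp_apply] at this
  rw [← this]
  simp

theorem twistCochain_mem {τ : G → G → C(X, Circle)} (hτ : IsTwistCocycle τ) :
    twistCochain τ ∈ cocycles G X 3 := by
  have hz : ∀ p q, ¬ (p = 3 ∧ q = 0) → ¬ (p = 2 ∧ q = 1) → twistCochain τ p q = 0 := by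
    intro p q h1 h2
    rw [twistCochain]
    · rintro rfl rfl; simp at h1
    · rintro rfl rfl; simp at h2
  have hpi : (2 * Real.pi) ≠ 0 := by positivity
  refine ⟨fun p q h => hz p q (by omega) (by omega), ?_⟩
  change totalD G X _ = 0
  funext p q
  change groupPart G X _ p q + singPart G X _ p q = 0
  by_cases hpq : p + q = 4
  swap
  · have h1 : groupPart G X (twistCochain τ) p q = 0 := by
      rcases p with _ | p
      · rfl
      · rw [groupPart, hz _ _ (by omega) (by omega), map_zero]
    have h2 : singPart G X (twistCochain τ) p q = 0 := by
      rcases q with _ | q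
      · rfl
      · rw [singPart, hz _ _ (by omega) (by omega), map_zero, mul_zero]
    rw [h1, h2, add_zero]
  obtain rfl | hp := eq_or_ne p 4
  · obtain rfl : q = 0 := by omega
    funext g σ
    rw [singPart, add_zero, groupPart]
    have h : ((dGroup G X 3 0 (twistCochain τ 3 0) g σ : ℤ) : ℝ) * (2 * Real.pi) = 0 := by
      simp only [dGroup, AddMonoidHom.coe_mk, ZeroHom.coe_mk, Fin.sum_univ_succ, Finset.univ_eq_empty, Finset.sum_empty]
      push_cast
      simp only [add_mul, mul_assoc, twistCochain_30 hτ]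
      simp [Fin.contractNth, translateSimplex, mul_assoc, mul_smul]
      ring
    simpa [hpi] using h
  obtain rfl | hp := eq_or_ne p 3
  · obtain rfl : q = 1 := by omega
    funext g σ
    rw [singPart, groupPart]
    have h : ((dGroup G X 2 1 (twistCochain τ 2 1) g σ +
        (-1) ^ 3 * dSing G X 3 0 (twistCochain τ 3 0) g σ : ℤ) : ℝ) * (2 * Real.pi) = 0 := by
      simp only [dGroup, dSing, AddMonoidHom.coe_mk, ZeroHom.coe_mk, Fin.sum_univ_succ, Finset.univ_eq_empty, Finset.sum_empty]
      push_cast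
      simp only [add_mul, mul_assoc, twistCochain_30 hτ, twistCochain_21]
      simp [Fin.contractNth, translateSimplex, mul_assoc, mul_smul]
      have hf := congrArg phaseVariation (show
          (τ (g 1) (g 2)).comp σ * (τ (g 0) (g 1 * g 2)).comp σ =
            (τ (g 0 * g 1) (g 2)).comp σ * (τ (g 0) (g 1)).comp (translateSimplex (g 2) σ) from
        ContinuousMap.ext fun t => hτ (g 0) (g 1) (g 2) (σ t))
      rw [phaseVariation_mul, phaseVariation_mul, translateSimplex] at hf
      simp only [faceInclusion_vertex]
      simp
      linarith
    have h' := h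
    rw [mul_eq_zero, or_iff_left hpi] at h'
    exact_mod_cast h'
  obtain rfl | hp := eq_or_ne p 2
  · obtain rfl : q = 2 := by omega
    funext g σ
    rw [singPart, groupPart, hz 1 2 (by omega) (by omega), map_zero, zero_add]
    have h : ((dSing G X 2 1 (twistCochain τ 2 1) g σ : ℤ) : ℝ) * (2 * Real.pi) = 0 := by
      simp only [dSing, AddMonoidHom.coe_mk, ZeroHom.coe_mk, Fin.sum_univ_succ, Finset.univ_eq_empty, Finset.sum_empty]
      push_cast
      simp only [add_mul, mul_assoc, twistCochain_21]
      have := phaseVariation_triangle ((τ (g 0) (g 1)).comp σ)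
      simp [faceInclusion_vertex]
      have e : (2 : Fin 3).succAbove (1 : Fin 2) = 1 := by decide
      rw [e]
      simp only [ContinuousMap.comp_assoc] at this
      linarith
    rw [mul_eq_zero, or_iff_left hpi] at h
    have h' : dSing G X 2 1 (twistCochain τ 2 1) g σ = 0 := by exact_mod_cast h
    change (-1) ^ 2 * _ = _
    simpa using h'
  have h1 : groupPart G X (twistCochain τ) p q = 0 := by
    rcases p with _ | p
    · rfl
    · rw [groupPart, hz _ _ (by omega) (by omega), map_zero]
  have h2 : singPart G X (twistCochain τ) p q = 0 := by
    rcases q with _ | q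
    · rfl
    · rw [singPart, hz _ _ (by omega) (by omega), map_zero, mul_zero]
  rw [h1, h2, add_zero]

/-- The class in `H³_G(X, ℤ)` of a `2`-cocycle of `G` with values in `C(X, U(1))`. -/
def twistClass (τ : G → G → C(X, Circle)) (hτ : IsTwistCocycle τ) : EquivariantCohomology G X 3 :=
  QuotientAddGroup.mk (⟨twistCochain τ, twistCochain_mem hτ⟩ : cocycles G X 3)

end Twist

/-! ## Space groups -/

/-- The vector group `ℝᵈ` with its Euclidean norm. -/
abbrev Space (d : ℕ) := EuclideanSpace ℝ (Fin d)

/-- The Euclidean group of isometries of `ℝᵈ`. -/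
abbrev EuclideanGroup (d : ℕ) := Space d ≃ᵃⁱ[ℝ] Space d

/-- The Euclidean group carries the product topology of `ℝᵈ ⋊ O(d)`: an isometry is recorded by its
translational part `f 0` and its linear part. -/
instance (d : ℕ) : TopologicalSpace (EuclideanGroup d) :=
  TopologicalSpace.induced (fun f => ((f 0, (f.linearIsometryEquiv : Space d →L[ℝ] Space d)) :
    Space d × (Space d →L[ℝ] Space d))) inferInstance

/-- A `d`-dimensional crystallographic space group: a discrete cocompact subgroup of the Euclidean
group. -/
structure IsSpaceGroup {d : ℕ} (Γ : Subgroup (EuclideanGroup d)) : Prop where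
  discrete : DiscreteTopology Γ
  cocompact : CompactSpace (EuclideanGroup d ⧸ Γ)

/-- The linear part `ℝᵈ ⋊ O(d) → O(d)`. -/
def linearPart (d : ℕ) : EuclideanGroup d →* (Space d ≃ₗᵢ[ℝ] Space d) where
  toFun f := f.linearIsometryEquiv
  map_one' := rfl
  map_mul' _ _ := rfl

/-- The element `(v, A)` of `ℝᵈ ⋊ O(d)`, i.e. the isometry `x ↦ v + A x`. -/
def euclideanMk {d : ℕ} (v : Space d) (A : Space d ≃ₗᵢ[ℝ] Space d) : EuclideanGroup d :=
  AffineIsometryEquiv.constVAdd ℝ (Space d) v * A.toAffineIsometryEquiv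

@[simp]
theorem euclideanMk_apply {d : ℕ} (v : Space d) (A : Space d ≃ₗᵢ[ℝ] Space d) (x : Space d) :
    euclideanMk v A x = v + A x := rfl

@[simp]
theorem linearPart_euclideanMk {d : ℕ} (v : Space d) (A : Space d ≃ₗᵢ[ℝ] Space d) :
    linearPart d (euclideanMk v A) = A := by
  ext x; rfl

theorem euclideanMk_mul {d : ℕ} (v w : Space d) (A B : Space d ≃ₗᵢ[ℝ] Space d) :
    euclideanMk v A * euclideanMk w B = euclideanMk (v + A w) (A * B) := by
  ext x : 1
  change v + A (w + B x) = v + A w + A (B x)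
  rw [map_add, add_assoc]

theorem euclideanMk_zero_one {d : ℕ} : euclideanMk (0 : Space d) 1 = 1 := by
  ext x : 1
  exact zero_add x

theorem euclideanMk_inv {d : ℕ} (v : Space d) (A : Space d ≃ₗᵢ[ℝ] Space d) :
    (euclideanMk v A)⁻¹ = euclideanMk (-(A⁻¹ v)) A⁻¹ := by
  rw [inv_eq_iff_mul_eq_one, euclideanMk_mul, mul_inv_cancel]
  have : A (A⁻¹ v) = v := A.apply_symm_apply v
  rw [map_neg, this, add_neg_cancel, euclideanMk_zero_one]

theorem eq_euclideanMk {d : ℕ} (f : EuclideanGroup d) : f = euclideanMk (f 0) (linearPart d f) := by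
  ext x : 1
  have h := f.map_vadd (0 : Space d) x
  simp only [vadd_eq_add, add_zero] at h
  rw [h, add_comm]
  rfl

section SpaceGroup

variable {d : ℕ} (Γ : Subgroup (EuclideanGroup d))

/-- The point group `G ⊆ O(d)`: the image of the space group in `O(d)`. -/
def pointGroup : Subgroup (Space d ≃ₗᵢ[ℝ] Space d) := Γ.map (linearPart d)

/-- The lattice `Π` of the translations which belong to the space group. -/
def lattice : AddSubgroup (Space d) where
  carrier := {v | euclideanMk v 1 ∈ Γ}
  zero_mem' := by simp [euclideanMk_zero_one]
  add_mem' {v w} hv hw := by simpa [euclideanMk_mul] using Γ.mul_mem hv hw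
  neg_mem' {v} hv := by simpa [euclideanMk_inv] using Γ.inv_mem hv

theorem mem_lattice {v : Space d} : v ∈ lattice Γ ↔ euclideanMk v 1 ∈ Γ := Iff.rfl

/-- A choice, for every `g` in the point group, of a lift `g̃ = (s̃ g, g)` of `g` in the space
group. -/
structure Splitting where
  toFun : pointGroup Γ → Space d
  mem : ∀ g, euclideanMk (toFun g) (g : Space d ≃ₗᵢ[ℝ] Space d) ∈ Γ

variable {Γ}

theorem sub_mem_lattice {v w : Space d} {A : Space d ≃ₗᵢ[ℝ] Space d} (hv : euclideanMk v A ∈ Γ)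
    (hw : euclideanMk w A ∈ Γ) : v - w ∈ lattice Γ := by
  have h := Γ.mul_mem hv (Γ.inv_mem hw)
  rw [euclideanMk_inv, euclideanMk_mul, mul_inv_cancel] at h
  have e : A (A⁻¹ w) = w := A.apply_symm_apply w
  rwa [map_neg, e, ← sub_eq_add_neg] at h

theorem map_mem_lattice (g : pointGroup Γ) {n : Space d} (hn : n ∈ lattice Γ) :
    (g : Space d ≃ₗᵢ[ℝ] Space d) n ∈ lattice Γ := by
  obtain ⟨g, f, hf, rfl⟩ := g
  have h := Γ.mul_mem (Γ.mul_mem hf hn) (Γ.inv_mem hf)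
  rw [eq_euclideanMk f, euclideanMk_inv, euclideanMk_mul, euclideanMk_mul] at h
  rw [mem_lattice]
  convert! h using 1
  have e : ∀ w, linearPart d f ((linearPart d f)⁻¹ w) = w := (linearPart d f).apply_symm_apply
  simp [e]

/-- The linear action of the point group on the lattice. -/
instance : DistribMulAction (pointGroup Γ) (lattice Γ) where
  smul g n := ⟨(g : Space d ≃ₗᵢ[ℝ] Space d) n, map_mem_lattice g n.2⟩
  one_smul _ := rfl
  mul_smul _ _ _ := rfl
  smul_zero g := Subtype.ext (map_zero _)
  smul_add g _ _ := Subtype.ext (map_add _ _ _)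

@[simp]
theorem coe_smul_lattice (g : pointGroup Γ) (n : lattice Γ) :
    ((g • n : lattice Γ) : Space d) = (g : Space d ≃ₗᵢ[ℝ] Space d) n := rfl

variable (Γ)

/-- The position torus `ℝᵈ / Π`. -/
def UnitCell : Type := Space d ⧸ lattice Γ

instance : AddCommGroup (UnitCell Γ) := inferInstanceAs (AddCommGroup (Space d ⧸ lattice Γ))

instance : TopologicalSpace (UnitCell Γ) :=
  inferInstanceAs (TopologicalSpace (Space d ⧸ lattice Γ))

variable {Γ}

/-- The class `[x]` in `ℝᵈ / Π` of `x ∈ ℝᵈ`. -/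
def UnitCell.mk (x : Space d) : UnitCell Γ := QuotientAddGroup.mk x

theorem UnitCell.mk_eq_mk {x y : Space d} :
    (UnitCell.mk x : UnitCell Γ) = UnitCell.mk y ↔ -x + y ∈ lattice Γ := QuotientAddGroup.eq

theorem UnitCell.mk_surjective : Function.Surjective (UnitCell.mk : Space d → UnitCell Γ) :=
  QuotientAddGroup.mk_surjective

/-- The map induced on `ℝᵈ / Π` by an element of the space group. -/
def UnitCell.map (f : EuclideanGroup d) (hf : f ∈ Γ) : UnitCell Γ → UnitCell Γ :=
  Quotient.map' f fun x y h => by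
    rw [QuotientAddGroup.leftRel_apply] at h ⊢
    have h' := map_mem_lattice (⟨_, f, hf, rfl⟩ : pointGroup Γ) h
    rw [eq_euclideanMk f]
    convert! h' using 1
    simp only [euclideanMk_apply, map_add, map_neg]
    abel

theorem UnitCell.map_mk (f : EuclideanGroup d) (hf : f ∈ Γ) (x : Space d) :
    UnitCell.map f hf (UnitCell.mk x) = UnitCell.mk (f x) := rfl

theorem UnitCell.map_congr {f f' : EuclideanGroup d} (hf : f ∈ Γ) (hf' : f' ∈ Γ)
    (h : linearPart d f = linearPart d f') (x : UnitCell Γ) :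
    UnitCell.map f hf x = UnitCell.map f' hf' x := by
  obtain ⟨x, rfl⟩ := UnitCell.mk_surjective x
  rw [UnitCell.map_mk, UnitCell.map_mk, UnitCell.mk_eq_mk]
  rw [eq_euclideanMk f] at hf ⊢
  rw [eq_euclideanMk f'] at hf' ⊢
  rw [← h] at hf' ⊢
  convert! sub_mem_lattice hf' hf using 1
  simp only [euclideanMk_apply]
  abel

/-- The affine action of the point group on `ℝᵈ / Π`, induced by the action of the space group on
`ℝᵈ`: an element `g` acts as any element of the space group with linear part `g`. -/
instance : MulAction (pointGroup Γ) (UnitCell Γ) where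
  smul g := UnitCell.map g.2.choose g.2.choose_spec.1
  one_smul x := by
    obtain ⟨y, rfl⟩ := UnitCell.mk_surjective x
    exact UnitCell.map_congr _ Γ.one_mem (1 : pointGroup Γ).2.choose_spec.2 _
  mul_smul g h x := by
    have e := UnitCell.map_congr (g * h).2.choose_spec.1
      (Γ.mul_mem g.2.choose_spec.1 h.2.choose_spec.1) (by
        rw [(g * h).2.choose_spec.2, map_mul, g.2.choose_spec.2, h.2.choose_spec.2]; rfl) x
    refine e.trans ?_
    obtain ⟨y, rfl⟩ := UnitCell.mk_surjective x
    rfl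

/-- The affine action is `g • [x] = [s̃ g + g x]` for every choice of lifts. -/
theorem UnitCell.smul_mk (s : Splitting Γ) (g : pointGroup Γ) (x : Space d) :
    g • (UnitCell.mk x : UnitCell Γ) =
      UnitCell.mk (s.toFun g + (g : Space d ≃ₗᵢ[ℝ] Space d) x) :=
  UnitCell.map_congr g.2.choose_spec.1 (s.mem g)
    (g.2.choose_spec.2.trans (linearPart_euclideanMk _ _).symm) (UnitCell.mk x)

instance : ContinuousConstSMul (pointGroup Γ) (UnitCell Γ) where
  continuous_const_smul g :=
    continuous_quot_lift _ (continuous_quot_mk.comp g.2.choose.continuous)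

variable (Γ)

/-- The Brillouin torus: the Pontryagin dual `Hom(Π, U(1))` of the lattice. -/
def BrillouinTorus : Type := PontryaginDual (Multiplicative (lattice Γ))

instance : TopologicalSpace (BrillouinTorus Γ) :=
  inferInstanceAs (TopologicalSpace (PontryaginDual (Multiplicative (lattice Γ))))

instance : CommGroup (BrillouinTorus Γ) :=
  inferInstanceAs (CommGroup (PontryaginDual (Multiplicative (lattice Γ))))

variable {Γ}

/-- The value `χ(n)` of a character at a lattice vector. -/
def BrillouinTorus.eval (χ : BrillouinTorus Γ) (n : lattice Γ) : Circle :=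
  (show Multiplicative (lattice Γ) →ₜ* Circle from χ) (Multiplicative.ofAdd n)

theorem BrillouinTorus.ext {χ ψ : BrillouinTorus Γ} (h : ∀ n, χ.eval n = ψ.eval n) : χ = ψ :=
  PontryaginDual.ext fun n => h n.toAdd

@[simp]
theorem BrillouinTorus.eval_zero (χ : BrillouinTorus Γ) : χ.eval 0 = 1 :=
  map_one (show Multiplicative (lattice Γ) →ₜ* Circle from χ)

@[simp]
theorem BrillouinTorus.eval_add (χ : BrillouinTorus Γ) (m n : lattice Γ) :
    χ.eval (m + n) = χ.eval m * χ.eval n :=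
  map_mul (show Multiplicative (lattice Γ) →ₜ* Circle from χ) _ _

@[simp]
theorem BrillouinTorus.eval_neg (χ : BrillouinTorus Γ) (n : lattice Γ) :
    χ.eval (-n) = (χ.eval n)⁻¹ :=
  map_inv (show Multiplicative (lattice Γ) →ₜ* Circle from χ) _

theorem BrillouinTorus.continuous_eval (n : lattice Γ) :
    Continuous fun χ : BrillouinTorus Γ => χ.eval n :=
  (ContinuousEvalConst.continuous_eval_const (F := Multiplicative (lattice Γ) →ₜ* Circle)
    (Multiplicative.ofAdd n))

/-- The linear action of an element of the point group on the lattice is continuous. -/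
def latticeMap (g : pointGroup Γ) : Multiplicative (lattice Γ) →ₜ* Multiplicative (lattice Γ) where
  toFun n := Multiplicative.ofAdd (g • n.toAdd)
  map_one' := congrArg Multiplicative.ofAdd (smul_zero g)
  map_mul' _ _ := congrArg Multiplicative.ofAdd (smul_add g _ _)
  continuous_toFun := by
    have : Continuous fun n : lattice Γ => g • n :=
      Continuous.subtype_mk
        ((g : Space d ≃ₗᵢ[ℝ] Space d).continuous.comp continuous_subtype_val) _
    exact this

/-- The dual action of the point group on the Brillouin torus, `(g • χ)(n) = χ(g⁻¹ n)`. -/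
instance : MulAction (pointGroup Γ) (BrillouinTorus Γ) where
  smul g χ := PontryaginDual.map (latticeMap g⁻¹) χ
  one_smul χ := BrillouinTorus.ext fun n => (by
    change χ.eval ((1 : pointGroup Γ)⁻¹ • n) = χ.eval n
    rw [inv_one, one_smul])
  mul_smul g h χ := BrillouinTorus.ext fun n =>
    congrArg χ.eval (by rw [mul_inv_rev, mul_smul]; rfl)

@[simp]
theorem BrillouinTorus.smul_eval (g : pointGroup Γ) (χ : BrillouinTorus Γ) (n : lattice Γ) :
    (g • χ).eval n = χ.eval (g⁻¹ • n) := rfl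

instance : ContinuousConstSMul (pointGroup Γ) (BrillouinTorus Γ) where
  continuous_const_smul g := (PontryaginDual.map (latticeMap g⁻¹)).continuous_toFun

/-- The `Π`-valued `2`-cocycle `ν(g, h) = s̃(g) + g s̃(h) - s̃(gh)` of the space group. -/
def latticeCocycle (s : Splitting Γ) (g h : pointGroup Γ) : lattice Γ :=
  ⟨s.toFun g + (g : Space d ≃ₗᵢ[ℝ] Space d) (s.toFun h) - s.toFun (g * h), by
    have hgh := Γ.mul_mem (s.mem g) (s.mem h)
    rw [euclideanMk_mul] at hgh
    exact sub_mem_lattice hgh (s.mem (g * h))⟩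

/-- The Fourier transformed cocycle `τ(g, h)(χ) = (gh • χ)(ν(g, h))`. -/
def dualCocycle (s : Splitting Γ) (g h : pointGroup Γ) : C(BrillouinTorus Γ, Circle) where
  toFun χ := ((g * h) • χ).eval (latticeCocycle s g h)
  continuous_toFun := (BrillouinTorus.continuous_eval _).comp (continuous_const_smul (g * h))

theorem latticeCocycle_eq (s : Splitting Γ) (g h k : pointGroup Γ) :
    g • latticeCocycle s h k + latticeCocycle s g (h * k) =
      latticeCocycle s (g * h) k + latticeCocycle s g h := by
  apply Subtype.ext
  simp only [AddSubgroup.coe_add, coe_smul_lattice, latticeCocycle, map_add, map_sub, mul_assoc]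
  have : ((g * h : pointGroup Γ) : Space d ≃ₗᵢ[ℝ] Space d) (s.toFun k) =
    (g : Space d ≃ₗᵢ[ℝ] Space d) ((h : Space d ≃ₗᵢ[ℝ] Space d) (s.toFun k)) := rfl
  rw [this]
  abel

theorem dualCocycle_isCocycle (s : Splitting Γ) : IsTwistCocycle (dualCocycle s) := by
  intro g h k χ
  have e := congrArg (fun n => ((g * (h * k)) • χ).eval n) (latticeCocycle_eq s g h k)
  simp only [BrillouinTorus.eval_add, dualCocycle, ContinuousMap.coe_mk] at e ⊢
  rw [← mul_assoc g h k] at e ⊢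
  have e' : ((g * h) • k • χ).eval (latticeCocycle s g h) =
      ((g * h * k) • χ).eval (latticeCocycle s g h) := by rw [smul_smul]
  rw [e', ← e]
  congr 1
  rw [BrillouinTorus.smul_eval, BrillouinTorus.smul_eval, smul_smul, mul_assoc g h k,
    mul_inv_rev g (h * k), inv_mul_cancel_right]

/-- The space `ℝᵈ/Π × Π̂`, with the product action of the point group. -/
abbrev ProductTorus (Γ : Subgroup (EuclideanGroup d)) := UnitCell Γ × BrillouinTorus Γ

/-- The pullback of the Fourier transformed cocycle along the projection to the Brillouin torus. -/
def pulledBackCocycle (s : Splitting Γ) (g h : pointGroup Γ) : C(ProductTorus Γ, Circle) :=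
  (dualCocycle s g h).comp ⟨Prod.snd, continuous_snd⟩

theorem pulledBackCocycle_isCocycle (s : Splitting Γ) : IsTwistCocycle (pulledBackCocycle s) :=
  fun g h k x => dualCocycle_isCocycle s g h k x.2

/-! ## The Poincaré line bundle -/

variable (Γ)

/-- The lattice acts on `ℝᵈ × Π̂ × ℂ` by `n : (x, χ, z) ↦ (x + n, χ, χ(n) z)`; this is the orbit
relation. -/
def poincareSetoid : Setoid (Space d × BrillouinTorus Γ × ℂ) where
  r a b := ∃ n : lattice Γ, b = (a.1 + n, a.2.1, (a.2.1.eval n : ℂ) * a.2.2)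
  iseqv :=
    { refl := fun a => ⟨0, by simp⟩
      symm := by
        rintro ⟨x, χ, z⟩ _ ⟨n, rfl⟩
        exact ⟨-n, by simp⟩
      trans := by
        rintro ⟨x, χ, z⟩ _ _ ⟨n, rfl⟩ ⟨m, rfl⟩
        exact ⟨n + m, by simp [add_assoc, mul_comm, mul_assoc]⟩ }

/-- The total space of the Poincaré line bundle, with the quotient topology. -/
def PoincareBundle : Type := Quotient (poincareSetoid Γ)

instance : TopologicalSpace (PoincareBundle Γ) :=
  inferInstanceAs (TopologicalSpace (Quotient (poincareSetoid Γ)))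

variable {Γ}

/-- The class `[x, χ, z]`. -/
def PoincareBundle.mk (x : Space d) (χ : BrillouinTorus Γ) (z : ℂ) : PoincareBundle Γ :=
  Quotient.mk (poincareSetoid Γ) (x, χ, z)

theorem PoincareBundle.mk_add (x : Space d) (χ : BrillouinTorus Γ) (z : ℂ) (n : lattice Γ) :
    PoincareBundle.mk (x + (n : Space d)) χ ((χ.eval n : ℂ) * z) = PoincareBundle.mk x χ z :=
  (Quotient.sound (s := poincareSetoid Γ) (a := (x, χ, z)) ⟨n, rfl⟩).symm

/-- The bundle projection `[x, χ, z] ↦ ([x], χ)`. -/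
def PoincareBundle.proj : PoincareBundle Γ → ProductTorus Γ :=
  Quotient.lift (fun a => (UnitCell.mk a.1, a.2.1)) (by
    rintro ⟨x, χ, z⟩ _ ⟨n, rfl⟩
    exact Prod.ext (UnitCell.mk_eq_mk.2 (by simp)) rfl)

theorem PoincareBundle.ind {P : PoincareBundle Γ → Prop}
    (h : ∀ x χ z, P (PoincareBundle.mk x χ z)) (v) : P v :=
  Quotient.ind (fun a => h a.1 a.2.1 a.2.2) v

/-- Fibrewise scalar multiplication `c • [x, χ, z] = [x, χ, c z]`. -/
instance : MulAction ℂ (PoincareBundle Γ) where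
  smul c := Quotient.map (fun a => (a.1, a.2.1, c * a.2.2)) (by
    rintro ⟨x, χ, z⟩ _ ⟨n, rfl⟩
    exact ⟨n, by simp [mul_left_comm]⟩)
  one_smul := PoincareBundle.ind fun x χ z => by
    change PoincareBundle.mk x χ (1 * z) = _
    rw [one_mul]
  mul_smul c c' := PoincareBundle.ind fun x χ z => by
    change PoincareBundle.mk x χ (c * c' * z) = PoincareBundle.mk x χ (c * (c' * z))
    rw [mul_assoc]

/-- The map `γ(g) : [x, χ, z] ↦ [s̃(g) + g x, g • χ, z]` of the Poincaré line bundle, covering the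
action of `g` on the base. -/
def poincareAction (s : Splitting Γ) (g : pointGroup Γ) : PoincareBundle Γ ≃ PoincareBundle Γ where
  toFun := Quotient.map
    (fun a => (s.toFun g + (g : Space d ≃ₗᵢ[ℝ] Space d) a.1, g • a.2.1, a.2.2)) (by
      rintro ⟨x, χ, z⟩ _ ⟨n, rfl⟩
      exact ⟨g • n, by simp [add_assoc]⟩)
  invFun := Quotient.map
    (fun a => ((g : Space d ≃ₗᵢ[ℝ] Space d).symm (a.1 - s.toFun g), g⁻¹ • a.2.1, a.2.2)) (by
      rintro ⟨x, χ, z⟩ _ ⟨n, rfl⟩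
      refine ⟨g⁻¹ • n, ?_⟩
      have : ((g⁻¹ • n : lattice Γ) : Space d) = (g : Space d ≃ₗᵢ[ℝ] Space d).symm n := rfl
      simp [this, add_sub_right_comm])
  left_inv := PoincareBundle.ind fun x χ z =>
    congrArg (Quotient.mk (poincareSetoid Γ)) (by simp)
  right_inv := PoincareBundle.ind fun x χ z =>
    congrArg (Quotient.mk (poincareSetoid Γ)) (by simp)

theorem poincareAction_mk (s : Splitting Γ) (g : pointGroup Γ) (x : Space d) (χ : BrillouinTorus Γ)
    (z : ℂ) : poincareAction s g (PoincareBundle.mk x χ z) =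
      PoincareBundle.mk (s.toFun g + (g : Space d ≃ₗᵢ[ℝ] Space d) x) (g • χ) z := rfl

theorem proj_poincareAction (s : Splitting Γ) (g : pointGroup Γ) : ∀ v : PoincareBundle Γ,
    PoincareBundle.proj (poincareAction s g v) = g • PoincareBundle.proj v :=
  PoincareBundle.ind fun x _ _ => Prod.ext (UnitCell.smul_mk s g x).symm rfl

theorem poincareAction_smul (s : Splitting Γ) (g : pointGroup Γ) (c : ℂ) : ∀ v : PoincareBundle Γ,
    poincareAction s g (c • v) = c • poincareAction s g v :=
  PoincareBundle.ind fun _ _ _ => rfl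

end SpaceGroup

/-! ## Line bundles and twisted equivariant structures -/

section LineBundle

variable {X : Type*} [TopologicalSpace X] {L : Type*} [TopologicalSpace L] [MulAction ℂ L]

/-- `proj : L → X` is a complex line bundle with fibrewise scalar multiplication given by the action of
`ℂ` on `L`: it is locally isomorphic to `U × ℂ`, compatibly with the scalar multiplication. (On a
one-dimensional fibre the addition is determined by the scalar multiplication.) -/
structure IsComplexLineBundle (proj : L → X) : Prop where
  locallyTrivial : ∀ x : X, ∃ e : Bundle.Trivialization ℂ proj, x ∈ e.baseSet ∧
    ∀ (c : ℂ) (v : L), proj v ∈ e.baseSet → e (c • v) = (proj v, c * (e v).2)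
  proj_smul : ∀ (c : ℂ) (v : L), proj (c • v) = proj v

/-- `proj : L → X` is a `τ`-twisted `G`-equivariant complex line bundle under the maps `γ g : L → L`, that
is, a trivialisation of the twist of `X // G` which is defined by `τ`: the `γ g` are bundle
isomorphisms covering the action of `G` on `X`, and `γ(g) γ(h) = τ(g, h) γ(g h)`. -/
structure IsTwistedEquivariantLineBundle {G : Type*} [Group G] [MulAction G X]
    (τ : G → G → C(X, Circle)) (proj : L → X) (γ : G → L → L) : Prop where
  isComplexLineBundle : IsComplexLineBundle proj
  isHomeomorph : ∀ g, IsHomeomorph (γ g)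
  proj_apply : ∀ g v, proj (γ g v) = g • proj v
  apply_smul : ∀ g (c : ℂ) v, γ g (c • v) = c • γ g v
  twisted : ∀ g h v, γ g (γ h v) = (τ g h (proj v) : ℂ) • γ (g * h) v

/-- The dual `Hom(L_x, ℂ)` of the fibre over `x`. (On a one-dimensional fibre the homogeneous functions
are the linear ones.) -/
@[ext]
structure DualFibre (proj : L → X) (x : X) where
  toFun : proj ⁻¹' {x} → ℂ
  map_smul : ∀ (c : ℂ) (v w : proj ⁻¹' {x}), (w : L) = c • (v : L) → toFun w = c * toFun v

/-- The total space of the dual line bundle `L*`, the disjoint union of the duals of the fibres. -/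
def DualBundle (proj : L → X) : Type _ := Σ x : X, DualFibre proj x

namespace DualBundle

variable {proj : L → X}

/-- The projection of the dual bundle. -/
def dualProj (proj : L → X) : DualBundle proj → X := Sigma.fst

/-- Fibrewise scalar multiplication on the dual bundle. -/
instance : MulAction ℂ (DualBundle proj) where
  smul c ξ := ⟨ξ.1, fun v => c * ξ.2.toFun v, fun a v w h => by
    rw [ξ.2.map_smul a v w h, mul_left_comm]⟩
  one_smul ξ := by
    obtain ⟨x, f⟩ := ξ
    exact congrArg (Sigma.mk x) (DualFibre.ext (funext fun v => one_mul _))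
  mul_smul a b ξ := by
    obtain ⟨x, f⟩ := ξ
    exact congrArg (Sigma.mk x) (DualFibre.ext (funext fun v => mul_assoc _ _ _))

/-- Pairs of a nonzero vector `v` of a fibre of `L` and a functional `ξ` on the same fibre. -/
abbrev Frame (proj : L → X) : Type _ := {p : L × DualBundle proj // proj p.1 = p.2.1 ∧ p.1 ≠ (0 : ℂ) • p.1}

/-- The pair `(v, ξ(v))`, which determines `(v, ξ)`. -/
def frameValue (p : Frame proj) : L × ℂ := (p.1.1, p.1.2.2.toFun ⟨p.1.1, p.2.1⟩)

/-- The topology of the dual bundle, as the bundle associated with the nonzero vectors of `L`: pairs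
`(v, ξ)` are topologised through `(v, ξ(v)) ∈ L × ℂ`, and the dual bundle is their quotient under
`(v, ξ) ↦ ξ`. -/
instance : TopologicalSpace (DualBundle proj) :=
  TopologicalSpace.coinduced (fun p : Frame proj => p.1.2)
    (TopologicalSpace.induced frameValue inferInstance)

/-- The contragredient `ξ ↦ ξ ∘ f⁻¹` of a fibrewise linear bijection `f` of `L` covering `φ`. -/
def dualMap (f : L ≃ L) (φ : X → X) (hφ : Function.Injective φ)
    (hf : ∀ v, proj (f v) = φ (proj v)) (hsmul : ∀ (c : ℂ) v, f (c • v) = c • f v) :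
    DualBundle proj → DualBundle proj :=
  fun ξ => ⟨φ ξ.1, fun w => ξ.2.toFun ⟨f.symm w, hφ (by
    rw [← hf, f.apply_symm_apply]; exact w.2)⟩, fun c v w h => ξ.2.map_smul c _ _ (by
      rw [f.symm_apply_eq, hsmul, f.apply_symm_apply]; exact h)⟩

end DualBundle

end LineBundle

/-- The dual Poincaré line bundle. -/
abbrev DualPoincareBundle {d : ℕ} (Γ : Subgroup (EuclideanGroup d)) : Type :=
  DualBundle (PoincareBundle.proj (Γ := Γ))

/-- The maps `γ*(g) : ξ ↦ ξ ∘ γ(g)⁻¹` of the dual Poincaré line bundle. -/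
def dualPoincareAction {d : ℕ} {Γ : Subgroup (EuclideanGroup d)} (s : Splitting Γ)
    (g : pointGroup Γ) :
    DualPoincareBundle Γ → DualPoincareBundle Γ :=
  DualBundle.dualMap (poincareAction s g) (fun x => g • x) (MulAction.injective g)
    (proj_poincareAction s g) (poincareAction_smul s g)

end CrystalTDuality

end

open CrystalTDuality

/-!
The Poincaré bundle with the maps `γ(g)` is twisted by the inverse of the cocycle: the lifts of `g`
and `h` compose to the lift of `g h` followed by the translation by `ν(g, h)`, and translating the
representative of `[x, χ, z]` by `n` changes `z` by the factor `χ(n)`. Passing to contragredient maps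
inverts the twist (`dualPoincareAction_twisted`). The lattice is discrete in `ℝᵈ`, so `ℝᵈ → ℝᵈ / Π` is
a covering, and its local sections give local frames `[l(y), χ, 1]` of the Poincaré bundle
(`PoincareBundle.isComplexLineBundle`); the dual of any line bundle is again a line bundle
(`IsComplexLineBundle.dual`).

A twisted line bundle trivialises the class of its twist because the cocycle becomes the coboundary
of the functions which describe the action in a frame. In general there is no global continuous
frame, so the argument is made on singular simplices. Choose for every singular simplex `σ` of
`ℝᵈ / Π × Π̂` a lift of its first component to `ℝᵈ`, that is, a frame of the bundle along `σ`. The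
choices are compared by constant lattice vectors: `k_i(σ)` between the lift of the `i`-th face and the
face of the lift (`faceDefect`), and `m(g; σ)` between `(s̃(g), g)` applied to the lift of `σ` and the
lift of `g • σ` (`actionDefect`). They satisfy

* `g m(h; σ) + m(g; h σ) = m(g h; σ) + ν(g, h)` (`actionDefect_mul`),
* `m(g; ∂ᵢ σ) + k_i(g σ) = m(g; σ) + g k_i(σ)` (`actionDefect_face`),
* `k_{j+1}(σ) + k_i(∂_{j+1} σ) = k_i(σ) + k_j(∂ᵢ σ)` for `i ≤ j` (`faceDefect_face`).

Let `A(x; n)` be a real phase of `χ(n)` at a point `x` and `V(σ; n)` the variation of the phase of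
`χ(n)` along a path `σ`. Put `α(g; x) = A(g x; m(g; x))`, `β(σ) = A(∂₀σ; k₀(σ)) - A(∂₁σ; k₁(σ))`, and let
`ρ` consist of `V(g σ; m(g; σ))` in bidegree `(1, 1)` and `∑ᵢ (-1)ⁱ V(∂ᵢσ; k_i(σ))` in bidegree `(0, 2)`.
By the three identities the total differential of `ρ` is the variation `Δ` of the phase of the
cocycle. With the phase `θ` of the cocycle, `θ - D(α, β) - ρ` therefore has differential `D θ - Δ`,
which is `2π` times the twist cochain; and again by the three identities its values lie in `2π ℤ`.
Dividing by `2π` gives an integral primitive (`totalD_primitive`).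
-/

noncomputable section

namespace CrystalTDuality

open Topology

/-! ### The lattice and the covering of the position torus -/

section Lattice

variable {d : ℕ} {Γ : Subgroup (EuclideanGroup d)}

/-- The lattice injects continuously into the discrete space group. -/
theorem discreteTopology_lattice [DiscreteTopology Γ] : DiscreteTopology (lattice Γ) := by
  refine DiscreteTopology.of_continuous_injective (β := Γ)
    (f := fun v => ⟨euclideanMk (v : Space d) 1, v.2⟩) ?_ fun v w h => Subtype.ext ?_
  · refine Continuous.subtype_mk (continuous_induced_rng.2 ?_) _
    have e : ∀ v : Space d, linearPart d (euclideanMk v 1) = 1 := fun v =>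
      linearPart_euclideanMk v 1
    have h : ((fun f : EuclideanGroup d => ((f 0, (f.linearIsometryEquiv : Space d →L[ℝ] Space d)) :
        Space d × (Space d →L[ℝ] Space d))) ∘ fun v : lattice Γ => euclideanMk (v : Space d) 1) =
        fun v : lattice Γ => ((v : Space d), ContinuousLinearMap.id ℝ (Space d)) := by
      funext v
      refine Prod.ext (by simp) ?_
      change (((linearPart d (euclideanMk (v : Space d) 1)) : Space d ≃ₗᵢ[ℝ] Space d) :
        Space d →L[ℝ] Space d) = _
      rw [e]
      rfl
    rw [h]
    fun_prop
  · simpa using congrArg (fun f : Γ => (f : EuclideanGroup d) 0) h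

theorem UnitCell.isOpenQuotientMap_mk : IsOpenQuotientMap (UnitCell.mk : Space d → UnitCell Γ) :=
  QuotientAddGroup.isOpenQuotientMap_mk

theorem UnitCell.continuous_mk : Continuous (UnitCell.mk : Space d → UnitCell Γ) :=
  UnitCell.isOpenQuotientMap_mk.continuous

theorem UnitCell.isCoveringMap_mk [DiscreteTopology (lattice Γ)] :
    IsCoveringMap (UnitCell.mk : Space d → UnitCell Γ) :=
  ((lattice Γ).isAddQuotientCoveringMap_of_comm
    DiscreteTopology.isDiscrete).isCoveringMap

theorem PoincareBundle.continuous_mk :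
    Continuous fun a : Space d × BrillouinTorus Γ × ℂ => PoincareBundle.mk a.1 a.2.1 a.2.2 :=
  continuous_quot_mk

theorem PoincareBundle.isQuotientMap_mk :
    IsQuotientMap fun a : Space d × BrillouinTorus Γ × ℂ => PoincareBundle.mk a.1 a.2.1 a.2.2 :=
  isQuotientMap_quot_mk

theorem BrillouinTorus.continuous_eval_uncurry [DiscreteTopology (lattice Γ)] :
    Continuous fun a : lattice Γ × BrillouinTorus Γ => a.2.eval a.1 :=
  continuous_prod_of_discrete_left.2 BrillouinTorus.continuous_eval

end Lattice

/-! ### Dual line bundles -/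

section Pairing

variable {X : Type*} {L : Type*} [MulAction ℂ L] {proj : L → X}

namespace DualBundle

theorem ext_of_apply {ξ η : DualBundle proj} (h : ξ.1 = η.1)
    (h' : ∀ v (hξ : proj v = ξ.1) (hη : proj v = η.1), ξ.2.toFun ⟨v, hξ⟩ = η.2.toFun ⟨v, hη⟩) :
    ξ = η := by
  obtain ⟨x, f⟩ := ξ
  obtain ⟨y, g⟩ := η
  obtain rfl : x = y := h
  exact congrArg (Sigma.mk x) (DualFibre.ext (funext fun v => h' v v.2 v.2))

open Classical in
/-- The pairing `ξ(v)` of a functional with a vector, with the value zero when they do not live over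
the same point. -/
def pairing (ξ : DualBundle proj) (v : L) : ℂ :=
  if h : proj v = ξ.1 then ξ.2.toFun ⟨v, h⟩ else 0

theorem pairing_eq (ξ : DualBundle proj) {v : L} (h : proj v = ξ.1) :
    ξ.pairing v = ξ.2.toFun ⟨v, h⟩ := dif_pos h

theorem pairing_smul (ξ : DualBundle proj) (hsmul : ∀ (c : ℂ) (v : L), proj (c • v) = proj v)
    (c : ℂ) {v : L} (h : proj v = ξ.1) : ξ.pairing (c • v) = c * ξ.pairing v := by
  rw [pairing_eq ξ h, pairing_eq ξ ((hsmul c v).trans h)]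
  exact ξ.2.map_smul c _ _ rfl

theorem smul_pairing (c : ℂ) (ξ : DualBundle proj) (v : L) :
    (c • ξ).pairing v = c * ξ.pairing v := by
  by_cases h : proj v = ξ.1
  · rw [pairing_eq ξ h]
    exact dif_pos h
  · rw [show ξ.pairing v = 0 from dif_neg h, mul_zero]
    exact dif_neg h

theorem ext_pairing {ξ η : DualBundle proj} (h : ξ.1 = η.1)
    (h' : ∀ v, proj v = ξ.1 → ξ.pairing v = η.pairing v) : ξ = η :=
  ext_of_apply h fun v hξ hη => by rw [← pairing_eq, ← pairing_eq, h' v hξ]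

theorem dualMap_pairing (f : L ≃ L) (φ : X → X) (hφ : Function.Injective φ)
    (hf : ∀ v, proj (f v) = φ (proj v)) (hsmul : ∀ (c : ℂ) v, f (c • v) = c • f v)
    (ξ : DualBundle proj) (v : L) :
    (dualMap f φ hφ hf hsmul ξ).pairing (f v) = ξ.pairing v := by
  by_cases h : proj v = ξ.1
  · have h' : proj (f v) = (dualMap f φ hφ hf hsmul ξ).1 := by
      rw [hf, h]; rfl
    rw [pairing_eq _ h, pairing_eq _ h']
    change ξ.2.toFun ⟨f.symm (f v), _⟩ = _
    congr 2
    exact f.symm_apply_apply _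
  · have h' : ¬ proj (f v) = (dualMap f φ hφ hf hsmul ξ).1 := by
      rw [hf]; exact fun e => h (hφ e)
    rw [pairing, pairing, dif_neg h, dif_neg h']

end DualBundle

end Pairing

section FrameSpace

variable {X : Type*} {L : Type*} [TopologicalSpace L] [MulAction ℂ L] {proj : L → X}

namespace DualBundle

/-- The pairs `(v, ξ)` of a nonzero vector and a functional on its fibre, with the topology induced
by `(v, ξ) ↦ (v, ξ(v))`. It is a separate type because `Frame proj` already has the subtype
topology. -/
def FrameSpace (proj : L → X) : Type _ := Frame proj

instance : TopologicalSpace (FrameSpace proj) :=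
  TopologicalSpace.induced frameValue inferInstance

/-- The map `(v, ξ) ↦ ξ`. -/
def FrameSpace.functional (p : FrameSpace proj) : DualBundle proj := p.1.2

/-- The pair `(v, ξ(v))`. -/
def FrameSpace.value (p : FrameSpace proj) : L × ℂ := frameValue p

theorem FrameSpace.continuous_value : Continuous (FrameSpace.value (proj := proj)) :=
  continuous_induced_dom

theorem FrameSpace.continuous_iff_value {Y : Type*} [TopologicalSpace Y] {f : Y → FrameSpace proj} :
    Continuous f ↔ Continuous fun y => (f y).value :=
  continuous_induced_rng

theorem continuous_functional : Continuous (FrameSpace.functional (proj := proj)) :=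
  continuous_coinduced_rng

theorem continuous_iff {Y : Type*} [TopologicalSpace Y] {f : DualBundle proj → Y} :
    Continuous f ↔ Continuous fun p : FrameSpace proj => f p.functional :=
  continuous_coinduced_dom

theorem continuous_dualMap (f : L ≃ L) (hf' : Continuous f) (φ : X → X)
    (hφ : Function.Injective φ)
    (hf : ∀ v, proj (f v) = φ (proj v)) (hsmul : ∀ (c : ℂ) v, f (c • v) = c • f v) :
    Continuous (dualMap f φ hφ hf hsmul) := by
  let F : FrameSpace proj → FrameSpace proj := fun p =>
    ⟨(f p.1.1, dualMap f φ hφ hf hsmul p.1.2), by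
      change proj (f p.1.1) = φ p.1.2.1
      rw [hf, p.2.1], by
      change f p.1.1 ≠ (0 : ℂ) • f p.1.1
      rw [← hsmul]
      exact fun h => p.2.2 (f.injective h)⟩
  have hF : Continuous F := by
    refine FrameSpace.continuous_iff_value.2 ?_
    have e1 : (fun p => (F p).value) = fun p : FrameSpace proj => (f p.value.1, p.value.2) := by
      funext p
      refine Prod.ext rfl ?_
      change p.1.2.2.toFun ⟨f.symm (f p.1.1), _⟩ = p.1.2.2.toFun ⟨p.1.1, _⟩
      congr 2
      exact f.symm_apply_apply _
    rw [e1]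
    exact ((hf'.comp continuous_fst).prodMk continuous_snd).comp FrameSpace.continuous_value
  exact continuous_iff.2 (continuous_functional.comp hF)

theorem isHomeomorph_dualMap (f : L ≃ L) (hf' : Continuous f) (hf'' : Continuous f.symm) (φ : X ≃ X)
    (hf : ∀ v, proj (f v) = φ (proj v)) (hsmul : ∀ (c : ℂ) v, f (c • v) = c • f v) :
    IsHomeomorph (dualMap f φ φ.injective hf hsmul) := by
  have hg : ∀ v, proj (f.symm v) = φ.symm (proj v) := fun v => by
    rw [Equiv.eq_symm_apply, ← hf, f.apply_symm_apply]
  have hg' : ∀ (c : ℂ) v, f.symm (c • v) = c • f.symm v := fun c v => by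
    rw [Equiv.symm_apply_eq, hsmul, f.apply_symm_apply]
  refine isHomeomorph_iff_exists_inverse.2 ⟨continuous_dualMap f hf' φ φ.injective hf hsmul,
    dualMap f.symm φ.symm φ.symm.injective hg hg', fun ξ => ?_, fun ξ => ?_,
    continuous_dualMap _ hf'' _ _ _ _⟩
  · refine ext_pairing (φ.symm_apply_apply _) fun v _ => ?_
    have := dualMap_pairing f.symm φ.symm φ.symm.injective hg hg'
      (dualMap f φ φ.injective hf hsmul ξ) (f v)
    rwa [f.symm_apply_apply, dualMap_pairing] at this
  · refine ext_pairing (φ.apply_symm_apply _) fun v _ => ?_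
    have := dualMap_pairing f φ φ.injective hf hsmul
      (dualMap f.symm φ.symm φ.symm.injective hg hg' ξ) (f.symm v)
    rwa [f.apply_symm_apply, dualMap_pairing] at this

end DualBundle

end FrameSpace

section LineBundle

variable {X : Type*} [TopologicalSpace X] {L : Type*} [TopologicalSpace L] [MulAction ℂ L]
  {proj : L → X}

/-- A local frame `sec` of a line bundle over `U`, together with the coordinate with respect to it,
gives a local trivialisation over `U`. -/
theorem exists_trivialization_of_section (hproj : Continuous proj)
    (hsmul : ∀ (c : ℂ) (v : L), proj (c • v) = proj v) {U : Set X} (hU : IsOpen U)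
    (sec : X → L) (coord : L → ℂ) (hsec : ∀ x ∈ U, proj (sec x) = x)
    (hcoord_sec : ∀ x ∈ U, ∀ z : ℂ, coord (z • sec x) = z)
    (hsec_coord : ∀ v, proj v ∈ U → coord v • sec (proj v) = v)
    (hcoord_cont : ContinuousOn coord (proj ⁻¹' U))
    (hsec_cont : ContinuousOn (fun p : X × ℂ => p.2 • sec p.1) (U ×ˢ Set.univ)) :
    ∃ e : Bundle.Trivialization ℂ proj, e.baseSet = U ∧
      ∀ (c : ℂ) (v : L), proj v ∈ e.baseSet → e (c • v) = (proj v, c * (e v).2) := by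
  have hproj_sec : ∀ p : X × ℂ, p.1 ∈ U → proj (p.2 • sec p.1) = p.1 := fun p hp => by
    rw [hsmul, hsec _ hp]
  refine ⟨{ toFun := fun v => (proj v, coord v)
            invFun := fun p => p.2 • sec p.1
            source := proj ⁻¹' U
            target := U ×ˢ Set.univ
            map_source' := fun v hv => ⟨hv, trivial⟩
            map_target' := fun p hp => by
              rw [Set.mem_preimage, hproj_sec p hp.1]
              exact hp.1
            left_inv' := fun v hv => hsec_coord v hv
            right_inv' := fun p hp => Prod.ext (hproj_sec p hp.1) (hcoord_sec _ hp.1 _)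
            open_source := hU.preimage hproj
            open_target := hU.prod isOpen_univ
            continuousOn_toFun := hproj.continuousOn.prodMk hcoord_cont
            continuousOn_invFun := hsec_cont
            baseSet := U
            open_baseSet := hU
            source_eq := rfl
            target_eq := rfl
            proj_toFun := fun _ _ => rfl }, rfl, fun c v hv => Prod.ext (hsmul c v) ?_⟩
  change coord (c • v) = c * coord v
  conv_lhs => rw [← hsec_coord v hv, smul_smul]
  exact hcoord_sec _ hv _

theorem IsComplexLineBundle.continuous_proj (h : IsComplexLineBundle proj) : Continuous proj :=
  continuous_iff_continuousAt.2 fun v => by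
    obtain ⟨e, he, -⟩ := h.locallyTrivial (proj v)
    exact e.continuousAt_proj (e.mem_source.2 he)

/-- The fibres carry only a scalar multiplication, so a vector is nonzero when it differs from its
multiple by `0`. Equivalently, its coordinate in a local trivialisation is nonzero. -/
theorem ne_zero_smul_iff_coordinate_ne_zero {e : Bundle.Trivialization ℂ proj}
    (he : ∀ (c : ℂ) (v : L), proj v ∈ e.baseSet → e (c • v) = (proj v, c * (e v).2))
    (hsmul : ∀ (c : ℂ) (v : L), proj (c • v) = proj v)
    {v : L} (hv : proj v ∈ e.baseSet) : v ≠ (0 : ℂ) • v ↔ (e v).2 ≠ 0 := by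
  rw [not_iff_not]
  have h1 : e ((0 : ℂ) • v) = (proj v, 0) := by rw [he _ _ hv, zero_mul]
  constructor
  · intro h
    rw [h, h1]
  · intro h
    have h2 : e v = e ((0 : ℂ) • v) := h1 ▸ Prod.ext (e.coe_fst' hv) h
    exact e.injOn (e.mem_source.2 hv) (e.mem_source.2 (by rwa [hsmul])) h2

open DualBundle in
/-- The dual of a line bundle is a line bundle: a local frame `v` gives the local coordinate
`ξ ↦ ξ(v)`. It is continuous because `ξ(v) = ξ(w) / a` for every pair `(w, ξ)` with `w = a v` and
`a ≠ 0`. -/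
theorem IsComplexLineBundle.dual (h : IsComplexLineBundle proj) :
    IsComplexLineBundle (dualProj proj) := by
  have hsurj : Function.Surjective (FrameSpace.functional (proj := proj)) := by
    intro ξ
    obtain ⟨e, hx, he⟩ := h.locallyTrivial ξ.1
    have hp := e.proj_symm_apply' (x := (1 : ℂ)) hx
    refine ⟨⟨(e.toOpenPartialHomeomorph.symm (ξ.1, 1), ξ), hp, ?_⟩, rfl⟩
    refine (ne_zero_smul_iff_coordinate_ne_zero he h.proj_smul (hp.symm ▸ hx)).2 ?_
    rw [e.apply_symm_apply' hx]
    exact one_ne_zero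
  have hquot : IsQuotientMap (FrameSpace.functional (proj := proj)) := ⟨⟨rfl⟩, hsurj⟩
  have hproj : Continuous (dualProj proj) := by
    refine DualBundle.continuous_iff.2 ?_
    have e : (fun p : FrameSpace proj => dualProj proj p.functional) =
        fun p : FrameSpace proj => proj p.value.1 := funext fun p => p.2.1.symm
    rw [e]
    exact h.continuous_proj.comp (continuous_fst.comp FrameSpace.continuous_value)
  refine ⟨fun x => ?_, fun c ξ => rfl⟩
  obtain ⟨e, hx, he⟩ := h.locallyTrivial x
  -- The local frame `v`; the dual frame `sec` is the coordinate functional of the trivialisation.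
  let v : X → L := fun y => e.toOpenPartialHomeomorph.symm (y, 1)
  have hv : ∀ y ∈ e.baseSet, proj (v y) = y := fun y hy => e.proj_symm_apply' hy
  have hev : ∀ y ∈ e.baseSet, e (v y) = (y, 1) := fun y hy => e.apply_symm_apply' hy
  have hw : ∀ w, proj w ∈ e.baseSet → (e w).2 • v (proj w) = w := fun w hw => by
    have hb : proj ((e w).2 • v (proj w)) = proj w := by rw [h.proj_smul, hv _ hw]
    have h2 : e ((e w).2 • v (proj w)) = e w := by
      rw [he _ _ (by rwa [hv _ hw]), hev _ hw, hv _ hw, mul_one]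
      exact Prod.ext (e.coe_fst' hw).symm rfl
    exact e.injOn (e.mem_source.2 (by rwa [hb])) (e.mem_source.2 hw) h2
  classical
  let sec : X → DualBundle proj := fun y => ⟨y, ⟨fun w => if y ∈ e.baseSet then (e w).2 else 0, by
    intro c w w' hww
    split_ifs with hy
    · rw [hww, he c w (by rw [w.2]; exact hy)]
    · rw [mul_zero]⟩⟩
  have hsec : ∀ y ∈ e.baseSet, ∀ w, proj w = y → (sec y).pairing w = (e w).2 := fun y hy w hw =>
    (pairing_eq (sec y) hw).trans (if_pos hy)
  suffices H : ∃ e' : Bundle.Trivialization ℂ (dualProj proj), e'.baseSet = e.baseSet ∧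
      ∀ (c : ℂ) (ξ : DualBundle proj), dualProj proj ξ ∈ e'.baseSet →
        e' (c • ξ) = (dualProj proj ξ, c * (e' ξ).2) by
    obtain ⟨e', hb, he'⟩ := H
    exact ⟨e', by rwa [hb], he'⟩
  refine exists_trivialization_of_section hproj
    (fun _ _ => rfl) e.open_baseSet sec (fun ξ => ξ.pairing (v ξ.1)) (fun _ _ => rfl)
    ?_ ?_ ?_ ?_
  · intro y hy z
    rw [smul_pairing]
    change z * (sec y).pairing (v y) = z
    rw [hsec y hy _ (hv y hy), hev y hy, mul_one]
  · intro ξ hξ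
    refine ext_pairing rfl fun w hwξ => ?_
    have hwξ : proj w = ξ.1 := hwξ
    have hξ : ξ.1 ∈ e.baseSet := hξ
    change (ξ.pairing (v ξ.1) • sec ξ.1).pairing w = _
    rw [smul_pairing, hsec _ hξ _ hwξ]
    conv_rhs => rw [← hw w (hwξ ▸ hξ), hwξ, pairing_smul _ h.proj_smul _ (hv _ hξ)]
    rw [mul_comm]
  · rw [hquot.continuousOn_isOpen_iff (e.open_baseSet.preimage hproj)]
    have hval : ∀ p : FrameSpace proj, p.functional.1 ∈ e.baseSet → (e p.value.1).2 ≠ 0 ∧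
        p.functional.pairing (v p.functional.1) = p.value.2 / (e p.value.1).2 := by
      rintro ⟨⟨w, ξ⟩, hwξ, hw0⟩ hξ
      have hξ : ξ.1 ∈ e.baseSet := hξ
      have hwξ : proj w = ξ.1 := hwξ
      have h0 : (e w).2 ≠ 0 :=
        (ne_zero_smul_iff_coordinate_ne_zero he h.proj_smul (hwξ.symm ▸ hξ)).1 hw0
      refine ⟨h0, ?_⟩
      change ξ.pairing (v ξ.1) = ξ.2.toFun ⟨w, hwξ⟩ / (e w).2
      rw [eq_div_iff h0, ← pairing_eq, mul_comm, ← pairing_smul _ h.proj_smul _ (hv _ hξ), ← hwξ,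
        hw w (hwξ.symm ▸ hξ)]
    refine ContinuousOn.congr (f := fun p : FrameSpace proj =>
      p.value.2 / (e p.value.1).2) ?_ fun p hp => (hval p hp).2
    refine ContinuousOn.div (continuous_snd.comp FrameSpace.continuous_value).continuousOn
      (continuous_snd.comp_continuousOn (e.continuousOn_toFun.comp
        (continuous_fst.comp FrameSpace.continuous_value).continuousOn fun p hp => ?_))
      fun p hp => (hval p hp).1
    refine e.mem_source.2 ?_
    change proj p.1.1 ∈ _
    rw [p.2.1]
    exact hp
  · rw [continuousOn_iff_continuous_domRestrict]
    let fr : e.baseSet ×ˢ (Set.univ : Set ℂ) → FrameSpace proj := fun p =>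
      ⟨(v p.1.1, p.1.2 • sec p.1.1), hv _ p.2.1, by
        refine (ne_zero_smul_iff_coordinate_ne_zero he h.proj_smul ?_).2 ?_
        · rw [hv _ p.2.1]; exact p.2.1
        · rw [hev _ p.2.1]; exact one_ne_zero⟩
    have hfr : Continuous fr := by
      refine FrameSpace.continuous_iff_value.2 ?_
      have e1 : (fun p => (fr p).value) = fun p => (v p.1.1, p.1.2) := by
        funext p
        refine Prod.ext rfl ?_
        change p.1.2 * (sec p.1.1).2.toFun ⟨v p.1.1, hv _ p.2.1⟩ = p.1.2
        rw [← pairing_eq, hsec _ p.2.1 _ (hv _ p.2.1), hev _ p.2.1, mul_one]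
      rw [e1]
      exact (e.continuousOn_symm_prodMk_left.comp_continuous
        (continuous_fst.comp continuous_subtype_val) fun p => p.2.1).prodMk
        (continuous_snd.comp continuous_subtype_val)
    exact continuous_functional.comp hfr

end LineBundle

/-! ### The Poincaré bundle -/

section PoincareBundle

variable {d : ℕ} {Γ : Subgroup (EuclideanGroup d)}

theorem PoincareBundle.smul_mk (c : ℂ) (x : Space d) (χ : BrillouinTorus Γ) (z : ℂ) :
    c • PoincareBundle.mk x χ z = PoincareBundle.mk x χ (c * z) := rfl

theorem PoincareBundle.proj_mk (x : Space d) (χ : BrillouinTorus Γ) (z : ℂ) :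
    PoincareBundle.proj (PoincareBundle.mk x χ z) = (UnitCell.mk x, χ) := rfl

theorem PoincareBundle.proj_smul (c : ℂ) : ∀ v : PoincareBundle Γ,
    PoincareBundle.proj (c • v) = PoincareBundle.proj v :=
  PoincareBundle.ind fun _ _ _ => rfl

theorem PoincareBundle.mk_injective (x : Space d) (χ : BrillouinTorus Γ) :
    Function.Injective (PoincareBundle.mk x χ) := by
  intro z z' h
  obtain ⟨n, hn⟩ := Quotient.exact h
  have h1 := congrArg Prod.fst hn
  have h2 := congrArg (fun a => a.2.2) hn
  simp only [left_eq_add, ZeroMemClass.coe_eq_zero] at h1 h2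
  subst h1
  simpa using h2.symm

theorem PoincareBundle.continuous_proj : Continuous (PoincareBundle.proj (Γ := Γ)) :=
  PoincareBundle.isQuotientMap_mk.continuous_iff.2 <|
    (UnitCell.continuous_mk.comp continuous_fst).prodMk (continuous_fst.comp continuous_snd)

/-- A local section `l` of `ℝᵈ → ℝᵈ / Π` gives the local frame `[l(y), χ, 1]`. Its coordinate at
`[x, χ, z]` is `χ(l([x]) - x) z`, which is continuous because the lattice is discrete. -/
theorem PoincareBundle.isComplexLineBundle [DiscreteTopology (lattice Γ)] :
    IsComplexLineBundle (PoincareBundle.proj (Γ := Γ)) := by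
  refine ⟨fun x => ?_, PoincareBundle.proj_smul⟩
  obtain ⟨x₀, hx₀⟩ := UnitCell.mk_surjective x.1
  obtain ⟨E, hxE, hE⟩ := (UnitCell.isCoveringMap_mk (Γ := Γ)).isLocalHomeomorph x₀
  let l : UnitCell Γ → Space d := E.symm
  let U : Set (UnitCell Γ) := E.target
  have hl : ∀ y ∈ U, UnitCell.mk (l y) = y := fun y hy => by rw [hE]; exact E.right_inv hy
  have hlc : ContinuousOn l U := E.continuousOn_symm
  have hxU : x.1 ∈ U := by rw [← hx₀, hE]; exact E.map_source hxE
  have hmem : ∀ y : Space d, UnitCell.mk y ∈ U → l (UnitCell.mk y) - y ∈ lattice Γ := fun y hy => by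
    have := UnitCell.mk_eq_mk.1 (hl _ hy).symm
    rwa [neg_add_eq_sub] at this
  classical
  -- The coordinate with respect to the frame; off the set `U` its value is irrelevant.
  let coord : PoincareBundle Γ → ℂ := fun v =>
    if h : ∃ z, v = PoincareBundle.mk (l v.proj.1) v.proj.2 z then h.choose else 0
  have hcoord : ∀ (y : UnitCell Γ), y ∈ U → ∀ χ z, coord (PoincareBundle.mk (l y) χ z) = z := by
    intro y hy χ z
    have hp : (PoincareBundle.mk (l y) χ z).proj = (y, χ) := by
      rw [PoincareBundle.proj_mk, hl y hy]
    have h : ∃ z', PoincareBundle.mk (l y) χ z = PoincareBundle.mk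
        (l (PoincareBundle.mk (l y) χ z).proj.1) (PoincareBundle.mk (l y) χ z).proj.2 z' :=
      ⟨z, by rw [hp]⟩
    have h1 := h.choose_spec
    rw [show coord (PoincareBundle.mk (l y) χ z) = h.choose from dif_pos h]
    generalize h.choose = w at h1 ⊢
    rw [hp] at h1
    exact (PoincareBundle.mk_injective _ _ h1).symm
  have hmk : ∀ (y : Space d) (hy : UnitCell.mk y ∈ U) (χ : BrillouinTorus Γ) (z : ℂ),
      PoincareBundle.mk y χ z =
        PoincareBundle.mk (l (UnitCell.mk y)) χ ((χ.eval ⟨_, hmem y hy⟩ : ℂ) * z) := by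
    intro y hy χ z
    rw [← PoincareBundle.mk_add y χ z ⟨_, hmem y hy⟩]
    simp
  have hU : IsOpen (U ×ˢ (Set.univ : Set (BrillouinTorus Γ))) := E.open_target.prod isOpen_univ
  suffices H : ∃ e : Bundle.Trivialization ℂ (PoincareBundle.proj (Γ := Γ)),
      e.baseSet = U ×ˢ Set.univ ∧ ∀ (c : ℂ) (v : PoincareBundle Γ), v.proj ∈ e.baseSet →
        e (c • v) = (v.proj, c * (e v).2) by
    obtain ⟨e, hb, he⟩ := H
    exact ⟨e, by rw [hb]; exact ⟨hxU, trivial⟩, he⟩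
  refine exists_trivialization_of_section PoincareBundle.continuous_proj PoincareBundle.proj_smul hU
    (fun y => PoincareBundle.mk (l y.1) y.2 1) coord ?_ ?_ ?_ ?_ ?_
  · intro y hy
    rw [PoincareBundle.proj_mk, hl _ hy.1]
  · intro y hy z
    rw [PoincareBundle.smul_mk, hcoord _ hy.1, mul_one]
  · refine PoincareBundle.ind fun y χ z hy => ?_
    have hy : UnitCell.mk y ∈ U := hy.1
    rw [PoincareBundle.proj_mk]
    conv_lhs => rw [hmk y hy χ z]
    rw [hcoord _ hy, PoincareBundle.smul_mk, mul_one, ← hmk _ hy]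
  · rw [PoincareBundle.isQuotientMap_mk.continuousOn_isOpen_iff
        (hU.preimage PoincareBundle.continuous_proj),
      continuousOn_iff_continuous_domRestrict]
    let V := (fun a : Space d × BrillouinTorus Γ × ℂ => PoincareBundle.mk a.1 a.2.1 a.2.2) ⁻¹'
      (PoincareBundle.proj ⁻¹' (U ×ˢ Set.univ))
    have hV : ∀ a : V, UnitCell.mk a.1.1 ∈ U := fun a => a.2.1
    have h1 : Continuous fun a : V => l (UnitCell.mk a.1.1) :=
      hlc.comp_continuous
        (UnitCell.continuous_mk.comp (continuous_fst.comp continuous_subtype_val)) hV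
    have h2 : Continuous fun a : V => (⟨_, hmem a.1.1 (hV a)⟩ : lattice Γ) :=
      Continuous.subtype_mk (h1.sub (continuous_fst.comp continuous_subtype_val)) _
    have h3 : Continuous fun a : V => a.1.2.1 := by fun_prop
    have h4 : Continuous fun a : V => a.1.2.2 := by fun_prop
    have h5 : Continuous fun a : V =>
        ((a.1.2.1.eval ⟨_, hmem a.1.1 (hV a)⟩ : Circle) : ℂ) * a.1.2.2 :=
      (continuous_subtype_val.comp
        (BrillouinTorus.continuous_eval_uncurry.comp (h2.prodMk h3))).mul h4
    refine h5.congr fun a => ?_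
    change _ = coord (PoincareBundle.mk a.1.1 a.1.2.1 a.1.2.2)
    rw [hmk _ (hV a), hcoord _ (hV a)]
  · have : ContinuousOn (fun p : ProductTorus Γ × ℂ => PoincareBundle.mk (l p.1.1) p.1.2 p.2)
        ((U ×ˢ Set.univ) ×ˢ Set.univ) := by
      refine PoincareBundle.continuous_mk.comp_continuousOn (f := fun p : ProductTorus Γ × ℂ =>
        (l p.1.1, p.1.2, p.2)) ?_
      refine (hlc.comp (continuous_fst.comp continuous_fst).continuousOn
        fun p hp => hp.1.1).prodMk ?_
      fun_prop
    refine this.congr fun p _ => ?_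
    rw [PoincareBundle.smul_mk, mul_one]

theorem continuous_poincareAction (s : Splitting Γ) (g : pointGroup Γ) :
    Continuous (poincareAction s g) := by
  have hc : Continuous fun a : Space d × BrillouinTorus Γ × ℂ =>
      (s.toFun g + (g : Space d ≃ₗᵢ[ℝ] Space d) a.1, g • a.2.1, a.2.2) :=
    (continuous_const.add ((g : Space d ≃ₗᵢ[ℝ] Space d).continuous.comp continuous_fst)).prodMk
      (((continuous_const_smul g).comp (continuous_fst.comp continuous_snd)).prodMk
        (continuous_snd.comp continuous_snd))
  exact PoincareBundle.isQuotientMap_mk.continuous_iff.2 (PoincareBundle.continuous_mk.comp hc)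

theorem continuous_poincareAction_symm (s : Splitting Γ) (g : pointGroup Γ) :
    Continuous (poincareAction s g).symm := by
  have hc : Continuous fun a : Space d × BrillouinTorus Γ × ℂ =>
      ((g : Space d ≃ₗᵢ[ℝ] Space d).symm (a.1 - s.toFun g), g⁻¹ • a.2.1, a.2.2) :=
    ((g : Space d ≃ₗᵢ[ℝ] Space d).symm.continuous.comp
      (continuous_fst.sub continuous_const)).prodMk
      (((continuous_const_smul g⁻¹).comp (continuous_fst.comp continuous_snd)).prodMk
        (continuous_snd.comp continuous_snd))
  exact PoincareBundle.isQuotientMap_mk.continuous_iff.2 (PoincareBundle.continuous_mk.comp hc)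

/-- The maps of the Poincaré bundle itself are twisted by the inverse of the cocycle, because
`s̃(g) + g (s̃(h) + h x) = (s̃(gh) + gh x) + ν(g, h)` and moving the representative by `ν(g, h)`
multiplies the last entry by `(gh • χ)(ν(g, h))`. -/
theorem poincareAction_mul (s : Splitting Γ) (g h : pointGroup Γ) : ∀ v : PoincareBundle Γ,
    poincareAction s (g * h) v =
      (pulledBackCocycle s g h v.proj : ℂ) • poincareAction s g (poincareAction s h v) :=
  PoincareBundle.ind fun x χ z => by
    rw [poincareAction_mk, poincareAction_mk, poincareAction_mk, PoincareBundle.smul_mk,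
      ← PoincareBundle.mk_add _ _ z (latticeCocycle s g h), smul_smul]
    congr 1
    change s.toFun (g * h) + (g : Space d ≃ₗᵢ[ℝ] Space d) ((h : Space d ≃ₗᵢ[ℝ] Space d) x) +
      (s.toFun g + (g : Space d ≃ₗᵢ[ℝ] Space d) (s.toFun h) - s.toFun (g * h)) = _
    rw [map_add]
    abel

/-- The twist of the contragredient maps is the inverse of the twist of the Poincaré bundle. -/
theorem dualPoincareAction_twisted (s : Splitting Γ) (g h : pointGroup Γ)
    (ξ : DualPoincareBundle Γ) :
    dualPoincareAction s g (dualPoincareAction s h ξ) =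
      (pulledBackCocycle s g h (DualBundle.dualProj _ ξ) : ℂ) • dualPoincareAction s (g * h) ξ := by
  refine DualBundle.ext_pairing (smul_smul g h ξ.1) fun v hv => ?_
  obtain ⟨w, rfl⟩ : ∃ w, v = poincareAction s g (poincareAction s h w) :=
    ⟨(poincareAction s h).symm ((poincareAction s g).symm v), by simp⟩
  have hw : w.proj = ξ.1 := by
    have : g • h • w.proj = g • h • ξ.1 := by
      rw [← proj_poincareAction s, ← proj_poincareAction s]
      exact hv
    exact MulAction.injective h (MulAction.injective g this)
  have h1 : (dualPoincareAction s (g * h) ξ).pairing (poincareAction s (g * h) w) = ξ.pairing w :=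
    DualBundle.dualMap_pairing _ _ _ _ _ _ _
  have h2 : (dualPoincareAction s g (dualPoincareAction s h ξ)).pairing
      (poincareAction s g (poincareAction s h w)) = ξ.pairing w :=
    (DualBundle.dualMap_pairing _ _ _ _ _ _ _).trans (DualBundle.dualMap_pairing _ _ _ _ _ _ _)
  rw [h2, ← h1, DualBundle.smul_pairing, poincareAction_mul,
    DualBundle.pairing_smul _ PoincareBundle.proj_smul]
  · rw [hw]; rfl
  · rw [hv]; exact smul_smul g h ξ.1

theorem isTwistedEquivariantLineBundle_dualPoincare [DiscreteTopology (lattice Γ)]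
    (s : Splitting Γ) :
    IsTwistedEquivariantLineBundle (pulledBackCocycle s)
      (DualBundle.dualProj (PoincareBundle.proj (Γ := Γ))) (dualPoincareAction s) where
  isComplexLineBundle := PoincareBundle.isComplexLineBundle.dual
  isHomeomorph g := DualBundle.isHomeomorph_dualMap (poincareAction s g)
    (continuous_poincareAction s g) (continuous_poincareAction_symm s g) (MulAction.toPerm g)
    (proj_poincareAction s g) (poincareAction_smul s g)
  proj_apply _ _ := rfl
  apply_smul _ _ _ := rfl
  twisted := dualPoincareAction_twisted s

end PoincareBundle

/-! ### Simplices and differentials in low degree -/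

section Simplices

variable {X : Type*} [TopologicalSpace X]

/-- The `i`-th face of a singular simplex. -/
def face {q : ℕ} (σ : Simplex (q + 1) X) (i : Fin (q + 2)) :
    Simplex q X := σ.comp (faceInclusion q i)

/-- The simplicial identity `∂ᵢ ∂ⱼ₊₁ = ∂ⱼ ∂ᵢ` for `i ≤ j`. -/
theorem face_face {q : ℕ} (σ : Simplex (q + 2) X)
    {i j : Fin (q + 2)} (hij : i ≤ j) :
    face (face σ j.succ) i = face (face σ i.castSucc) j := by
  refine ContinuousMap.ext fun t => congrArg σ ?_
  change stdSimplex.map _ (stdSimplex.map _ t) = stdSimplex.map _ (stdSimplex.map _ t)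
  rw [stdSimplex.map_comp_apply, stdSimplex.map_comp_apply]
  congr 1
  funext k
  simp only [Function.comp_apply, Fin.succAbove, Fin.lt_def, Fin.le_def, Fin.ext_iff] at *
  grind

theorem face_vertex_zero (σ : Simplex 1 X) :
    face σ 0 (stdSimplex.vertex 0) = σ (stdSimplex.vertex 1) :=
  congrArg σ (faceInclusion_vertex 0 0 0)

theorem face_vertex_one (σ : Simplex 1 X) :
    face σ 1 (stdSimplex.vertex 0) = σ (stdSimplex.vertex 0) :=
  congrArg σ (faceInclusion_vertex 0 1 0)

variable {G : Type*}

theorem dSing_zero {p : ℕ} (c : BiCochain G X p 0) (g : Fin p → G) (σ : Simplex 1 X) :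
    dSing G X p 0 c g σ = c g (face σ 0) - c g (face σ 1) := by
  change ∑ i : Fin 2, (-1) ^ i.val * c g (face σ i) = _
  simp [Fin.sum_univ_succ]
  ring

theorem dSing_one {p : ℕ} (c : BiCochain G X p 1) (g : Fin p → G) (σ : Simplex 2 X) :
    dSing G X p 1 c g σ = c g (face σ 0) - c g (face σ 1) + c g (face σ 2) := by
  change ∑ i : Fin 3, (-1) ^ i.val * c g (face σ i) = _
  simp [Fin.sum_univ_succ]
  ring

theorem dSing_two {p : ℕ} (c : BiCochain G X p 2) (g : Fin p → G) (σ : Simplex 3 X) :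
    dSing G X p 2 c g σ =
      c g (face σ 0) - c g (face σ 1) + c g (face σ 2) - c g (face σ 3) := by
  change ∑ i : Fin 4, (-1) ^ i.val * c g (face σ i) = _
  simp [Fin.sum_univ_succ]
  ring

theorem twistCochain_eq_zero [Group G] [MulAction G X] (τ : G → G → C(X, Circle)) {p q : ℕ}
    (h : p + q ≠ 3 ∨ p ≤ 1) :
    twistCochain τ p q = 0 := by
  rw [twistCochain]
  · rintro rfl rfl; simp at h
  · rintro rfl rfl; simp at h

end Simplices

section Nerve

variable {G : Type*} [Group G] {X : Type*} [TopologicalSpace X] [MulAction G X]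
  [ContinuousConstSMul G X]

theorem face_translateSimplex {q : ℕ} (g : G) (σ : Simplex (q + 1) X) (i : Fin (q + 2)) :
    face (translateSimplex g σ) i = translateSimplex g (face σ i) := rfl

theorem translateSimplex_mul {q : ℕ} (g h : G) (σ : Simplex q X) :
    translateSimplex (g * h) σ = translateSimplex g (translateSimplex h σ) :=
  ContinuousMap.ext fun t => mul_smul g h (σ t)

theorem dGroup_zero {q : ℕ} (f : Simplex q X → ℤ) (g : Fin 1 → G) (σ : Simplex q X) :
    dGroup G X 0 q (fun _ => f) g σ = f σ - f (translateSimplex (g 0) σ) := by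
  simp [dGroup]
  ring

theorem dGroup_one {q : ℕ} (f : G → Simplex q X → ℤ) (g : Fin 2 → G) (σ : Simplex q X) :
    dGroup G X 1 q (fun g => f (g 0)) g σ =
      f (g 1) σ - f (g 0 * g 1) σ + f (g 0) (translateSimplex (g 1) σ) := by
  simp [dGroup, Fin.contractNth]
  ring_nf

theorem dGroup_two {q : ℕ} (f : G → G → Simplex q X → ℤ) (g : Fin 3 → G) (σ : Simplex q X) :
    dGroup G X 2 q (fun g => f (g 0) (g 1)) g σ =
      f (g 1) (g 2) σ - f (g 0 * g 1) (g 2) σ + f (g 0) (g 1 * g 2) σ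
        - f (g 0) (g 1) (translateSimplex (g 2) σ) := by
  simp [dGroup, Fin.contractNth, Fin.sum_univ_succ]
  ring_nf

end Nerve

theorem exp_eq_one_iff_coe_angle_eq_zero {r : ℝ} : Circle.exp r = 1 ↔ (r : Real.Angle) = 0 := by
  rw [← Real.Angle.toCircle_coe]
  refine ⟨fun h => ?_, fun h => by rw [h, Real.Angle.toCircle_zero]⟩
  rw [← Real.Angle.arg_toCircle r, h]
  simp

/-! ### Lifts of singular simplices -/

section Lifts

variable {d : ℕ} {Γ : Subgroup (EuclideanGroup d)}

/-- Evaluation at a lattice vector of the characters along a singular simplex. -/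
def characterValue {q : ℕ} (σ : Simplex q (ProductTorus Γ)) (n : lattice Γ) : Simplex q Circle :=
  ⟨fun t => (σ t).2.eval n,
    (BrillouinTorus.continuous_eval n).comp (continuous_snd.comp σ.continuous)⟩

theorem characterValue_add {q : ℕ} (σ : Simplex q (ProductTorus Γ)) (m n : lattice Γ) :
    characterValue σ (m + n) = characterValue σ m * characterValue σ n :=
  ContinuousMap.ext fun _ => BrillouinTorus.eval_add _ m n

theorem characterValue_translate {q : ℕ} (g : pointGroup Γ) (σ : Simplex q (ProductTorus Γ))
    (n : lattice Γ) : characterValue (translateSimplex g σ) (g • n) = characterValue σ n :=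
  ContinuousMap.ext fun t => by
    change (g • (σ t).2).eval (g • n) = (σ t).2.eval n
    rw [BrillouinTorus.smul_eval, inv_smul_smul]

theorem characterValue_face {q : ℕ} (σ : Simplex (q + 1) (ProductTorus Γ)) (i : Fin (q + 2))
    (n : lattice Γ) : characterValue (face σ i) n = face (characterValue σ n) i := rfl

/-- The phase in `(-π, π]` of `χ(n)` at a point `([x], χ)`. -/
def pointPhase (σ : Simplex 0 (ProductTorus Γ)) (n : lattice Γ) : ℝ :=
  Complex.arg (characterValue σ n (stdSimplex.vertex 0))

/-- The variation of the phase of `χ(n)` along a path. -/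
def pathPhase (σ : Simplex 1 (ProductTorus Γ)) (n : lattice Γ) : ℝ :=
  phaseVariation (characterValue σ n)

theorem pointPhase_add (σ : Simplex 0 (ProductTorus Γ)) (m n : lattice Γ) :
    (pointPhase σ (m + n) : Real.Angle) = pointPhase σ m + pointPhase σ n := by
  rw [pointPhase, characterValue_add, ContinuousMap.mul_apply, Circle.coe_mul,
    Complex.arg_mul_coe_angle (Circle.coe_ne_zero _) (Circle.coe_ne_zero _)]
  rfl

theorem pointPhase_translate (g : pointGroup Γ) (σ : Simplex 0 (ProductTorus Γ)) (n : lattice Γ) :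
    pointPhase (translateSimplex g σ) (g • n) = pointPhase σ n := by
  rw [pointPhase, characterValue_translate, pointPhase]

theorem pathPhase_add (σ : Simplex 1 (ProductTorus Γ)) (m n : lattice Γ) :
    pathPhase σ (m + n) = pathPhase σ m + pathPhase σ n := by
  rw [pathPhase, characterValue_add, phaseVariation_mul]
  rfl

theorem pathPhase_translate (g : pointGroup Γ) (σ : Simplex 1 (ProductTorus Γ)) (n : lattice Γ) :
    pathPhase (translateSimplex g σ) (g • n) = pathPhase σ n := by
  rw [pathPhase, characterValue_translate, pathPhase]

/-- Modulo `2π`, the variation of a phase along a path is the difference of the phases at its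
ends. -/
theorem coe_pathPhase (σ : Simplex 1 (ProductTorus Γ)) (n : lattice Γ) :
    (pathPhase σ n : Real.Angle) = pointPhase (face σ 0) n - pointPhase (face σ 1) n := by
  rw [← Real.Angle.coe_sub, ← sub_eq_zero, ← Real.Angle.coe_sub, ← exp_eq_one_iff_coe_angle_eq_zero,
    Circle.exp_sub, Circle.exp_sub, pointPhase, pointPhase, Circle.exp_arg, Circle.exp_arg,
    characterValue_face, characterValue_face, face_vertex_zero, face_vertex_one, pathPhase,
    ← exp_phaseVariation (characterValue σ n)]
  simp

theorem pathPhase_boundary (σ : Simplex 2 (ProductTorus Γ)) (n : lattice Γ) :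
    pathPhase (face σ 0) n - pathPhase (face σ 1) n + pathPhase (face σ 2) n = 0 :=
  phaseVariation_triangle (characterValue σ n)

/-- Two continuous lifts to `ℝᵈ` of the same map from a connected space to `ℝᵈ / Π` differ by a
constant lattice vector. -/
theorem exists_lattice_translation [DiscreteTopology (lattice Γ)] {A : Type*} [TopologicalSpace A]
    [PreconnectedSpace A] [Nonempty A] (F F' : C(A, Space d))
    (h : ∀ t, (UnitCell.mk (F t) : UnitCell Γ) = UnitCell.mk (F' t)) :
    ∃ n : lattice Γ, ∀ t, F t = F' t + n := by
  have hmem : ∀ t, F t - F' t ∈ lattice Γ := fun t => by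
    have := UnitCell.mk_eq_mk.1 (h t).symm
    rwa [neg_add_eq_sub] at this
  have hc : Continuous fun t => (⟨_, hmem t⟩ : lattice Γ) :=
    Continuous.subtype_mk (F.continuous.sub F'.continuous) _
  refine ⟨⟨_, hmem (Classical.arbitrary A)⟩, fun t => ?_⟩
  have := congrArg Subtype.val
    (PreconnectedSpace.constant ‹_› hc (x := t) (y := Classical.arbitrary A))
  change F t - F' t = _ at this
  rw [← this]
  abel

variable [DiscreteTopology (lattice Γ)]

theorem exists_simplexLift {q : ℕ} (σ : Simplex q (ProductTorus Γ)) :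
    ∃ F : C(stdSimplex ℝ (Fin (q + 1)), Space d), ∀ t, UnitCell.mk (F t) = (σ t).1 := by
  obtain ⟨e, he⟩ := UnitCell.mk_surjective (σ (stdSimplex.vertex 0)).1
  obtain ⟨F, hF, -⟩ := (UnitCell.isCoveringMap_mk (Γ := Γ)).existsUnique_continuousMap_lifts
    ⟨fun t => (σ t).1, continuous_fst.comp σ.continuous⟩ (stdSimplex.vertex 0) e he
  exact ⟨F, fun t => congrFun hF.2 t⟩

/-- A choice of a lift to `ℝᵈ` of the first component of a singular simplex of `ℝᵈ / Π × Π̂`. -/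
def simplexLift {q : ℕ} (σ : Simplex q (ProductTorus Γ)) :
    C(stdSimplex ℝ (Fin (q + 1)), Space d) := (exists_simplexLift σ).choose

theorem mk_simplexLift {q : ℕ} (σ : Simplex q (ProductTorus Γ)) (t) :
    UnitCell.mk (simplexLift σ t) = (σ t).1 := (exists_simplexLift σ).choose_spec t

theorem exists_faceDefect {q : ℕ} (σ : Simplex (q + 1) (ProductTorus Γ)) (i : Fin (q + 2)) :
    ∃ n : lattice Γ, ∀ t, simplexLift (face σ i) t = simplexLift σ (faceInclusion q i t) + n :=
  exists_lattice_translation (simplexLift (face σ i)) ((simplexLift σ).comp (faceInclusion q i))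
    fun t => by rw [mk_simplexLift, ContinuousMap.comp_apply, mk_simplexLift]; rfl

/-- The lattice vector by which the lift of a face differs from the face of the lift: `k_i(σ)`. -/
def faceDefect {q : ℕ} (σ : Simplex (q + 1) (ProductTorus Γ)) (i : Fin (q + 2)) : lattice Γ :=
  (exists_faceDefect σ i).choose

theorem simplexLift_face {q : ℕ} (σ : Simplex (q + 1) (ProductTorus Γ)) (i : Fin (q + 2)) (t) :
    simplexLift (face σ i) t = simplexLift σ (faceInclusion q i t) + faceDefect σ i :=
  (exists_faceDefect σ i).choose_spec t

variable (s : Splitting Γ)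

theorem exists_actionDefect {q : ℕ} (g : pointGroup Γ) (σ : Simplex q (ProductTorus Γ)) :
    ∃ n : lattice Γ, ∀ t, s.toFun g + (g : Space d ≃ₗᵢ[ℝ] Space d) (simplexLift σ t) =
      simplexLift (translateSimplex g σ) t + n :=
  exists_lattice_translation
    ⟨fun t => s.toFun g + (g : Space d ≃ₗᵢ[ℝ] Space d) (simplexLift σ t), by fun_prop⟩
    (simplexLift (translateSimplex g σ)) fun t => by
      rw [mk_simplexLift, ContinuousMap.coe_mk, ← UnitCell.smul_mk, mk_simplexLift]
      rfl

/-- The lattice vector by which the image of the lift of a simplex under `(s̃(g), g)` differs from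
the lift of the image: `m(g; σ)`. -/
def actionDefect {q : ℕ} (g : pointGroup Γ) (σ : Simplex q (ProductTorus Γ)) : lattice Γ :=
  (exists_actionDefect s g σ).choose

theorem action_simplexLift {q : ℕ} (g : pointGroup Γ) (σ : Simplex q (ProductTorus Γ)) (t) :
    s.toFun g + (g : Space d ≃ₗᵢ[ℝ] Space d) (simplexLift σ t) =
      simplexLift (translateSimplex g σ) t + actionDefect s g σ :=
  (exists_actionDefect s g σ).choose_spec t

/-- The vectors `m(g; σ)` form a group cochain with differential `ν`: both sides compare the lift of
`(g h) • σ` with `(s̃(g), g) (s̃(h), h)` applied to the lift of `σ`. -/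
theorem actionDefect_mul {q : ℕ} (g h : pointGroup Γ) (σ : Simplex q (ProductTorus Γ)) :
    g • actionDefect s h σ + actionDefect s g (translateSimplex h σ) =
      actionDefect s (g * h) σ + latticeCocycle s g h := by
  have h1 := action_simplexLift s h σ (stdSimplex.vertex 0)
  have h2 := action_simplexLift s g (translateSimplex h σ) (stdSimplex.vertex 0)
  have h3 := action_simplexLift s (g * h) σ (stdSimplex.vertex 0)
  rw [translateSimplex_mul] at h3
  have h4 := congrArg (g : Space d ≃ₗᵢ[ℝ] Space d) h1
  rw [map_add, map_add] at h4
  have h5 : ((g * h : pointGroup Γ) : Space d ≃ₗᵢ[ℝ] Space d)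
      (simplexLift σ (stdSimplex.vertex 0)) =
      (g : Space d ≃ₗᵢ[ℝ] Space d) ((h : Space d ≃ₗᵢ[ℝ] Space d)
        (simplexLift σ (stdSimplex.vertex 0))) := rfl
  rw [h5] at h3
  refine Subtype.ext ?_
  simp only [AddSubgroup.coe_add, coe_smul_lattice, latticeCocycle]
  linear_combination (norm := module) h3 - h2 - h4

/-- Passing to a face and translating commute, so the two ways of comparing lifts agree. -/
theorem actionDefect_face {q : ℕ} (g : pointGroup Γ) (σ : Simplex (q + 1) (ProductTorus Γ))
    (i : Fin (q + 2)) :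
    actionDefect s g (face σ i) + faceDefect (translateSimplex g σ) i =
      actionDefect s g σ + g • faceDefect σ i := by
  have h1 := action_simplexLift s g (face σ i) (stdSimplex.vertex 0)
  have h2 := simplexLift_face (translateSimplex g σ) i (stdSimplex.vertex 0)
  have h3 := simplexLift_face σ i (stdSimplex.vertex 0)
  have h4 := action_simplexLift s g σ (faceInclusion q i (stdSimplex.vertex 0))
  rw [h3, map_add, ← face_translateSimplex] at h1
  refine Subtype.ext ?_
  simp only [AddSubgroup.coe_add, coe_smul_lattice]
  linear_combination (norm := module) h4 - h1 - h2

/-- The lattice vector which compares the lift of a face of codimension two with the face of the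
lift depends only on that face, not on the order in which the two vertices are omitted. -/
theorem faceDefect_face {q : ℕ} (σ : Simplex (q + 2) (ProductTorus Γ)) {i j : Fin (q + 2)}
    (hij : i ≤ j) :
    faceDefect σ j.succ + faceDefect (face σ j.succ) i =
      faceDefect σ i.castSucc + faceDefect (face σ i.castSucc) j := by
  let t : stdSimplex ℝ (Fin (q + 1)) := stdSimplex.vertex 0
  have h1 := simplexLift_face (face σ j.succ) i t
  have h2 := simplexLift_face σ j.succ (faceInclusion q i t)
  have h3 := simplexLift_face (face σ i.castSucc) j t
  have h4 := simplexLift_face σ i.castSucc (faceInclusion q j t)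
  rw [face_face σ hij] at h1
  have h5 : faceInclusion (q + 1) j.succ (faceInclusion q i t) =
      faceInclusion (q + 1) i.castSucc (faceInclusion q j t) :=
    congrArg (fun f => f t) (face_face (ContinuousMap.id (stdSimplex ℝ (Fin (q + 2 + 1)))) hij)
  rw [h5] at h2
  refine Subtype.ext ?_
  simp only [AddSubgroup.coe_add]
  linear_combination (norm := module) h3 + h4 - h1 - h2

end Lifts

/-! ### The primitive of the twist cochain -/

section Primitive

variable {d : ℕ} {Γ : Subgroup (EuclideanGroup d)}

theorem coe_angle_pulledBackCocycle (s : Splitting Γ) (g h : pointGroup Γ)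
    (σ : Simplex 0 (ProductTorus Γ)) :
    angle (pulledBackCocycle s) g h (σ (stdSimplex.vertex 0)) =
      pointPhase (translateSimplex (g * h) σ) (latticeCocycle s g h) := rfl

theorem phaseVariation_pulledBackCocycle (s : Splitting Γ) (g h : pointGroup Γ)
    (σ : Simplex 1 (ProductTorus Γ)) :
    phaseVariation ((pulledBackCocycle s g h).comp σ) =
      pathPhase (translateSimplex (g * h) σ) (latticeCocycle s g h) := rfl

variable [DiscreteTopology (lattice Γ)]

/-- The phase `α(g; x)` of the factor by which `γ*(g)` changes the frames of the dual bundle which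
are dual to `[x̃, χ, 1]`, for the chosen lift `x̃` of the point `x`. -/
def actionPhase (s : Splitting Γ) (g : pointGroup Γ) (σ : Simplex 0 (ProductTorus Γ)) : ℝ :=
  pointPhase (translateSimplex g σ) (actionDefect s g σ)

/-- The difference `β(σ)` of the phases, at the two ends of a path, of the factors which compare the
frame along the path with the frames at its ends. -/
def boundaryPhase (σ : Simplex 1 (ProductTorus Γ)) : ℝ :=
  pointPhase (face σ 0) (faceDefect σ 0) - pointPhase (face σ 1) (faceDefect σ 1)

/-- The primitive in bidegree `(2, 0)`, times `2π`: the group differential of `α` is subtracted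
from the phase of the cocycle. -/
def primitiveTwoZero (s : Splitting Γ) (g h : pointGroup Γ) (σ : Simplex 0 (ProductTorus Γ)) : ℝ :=
  angle (pulledBackCocycle s) g h (σ (stdSimplex.vertex 0)) -
    (actionPhase s h σ - actionPhase s (g * h) σ + actionPhase s g (translateSimplex h σ))

/-- The primitive in bidegree `(1, 1)`, times `2π`. Besides the component of `-D(α, β)` it contains,
with a minus sign, the variation along `σ` of the phase of the factor by which `g` changes the frames
along simplices. -/
def primitiveOneOne (s : Splitting Γ) (g : pointGroup Γ) (σ : Simplex 1 (ProductTorus Γ)) : ℝ :=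
  actionPhase s g (face σ 0) - actionPhase s g (face σ 1)
    - pathPhase (translateSimplex g σ) (actionDefect s g σ)
    - (boundaryPhase σ - boundaryPhase (translateSimplex g σ))

/-- The primitive in bidegree `(0, 2)`, times `2π`: the component `-∂β` of `-D(α, β)` minus the
variations, along the three edges, of the phases which compare the frames along the edges with the
frame over the triangle. -/
def primitiveZeroTwo (σ : Simplex 2 (ProductTorus Γ)) : ℝ :=
  -(boundaryPhase (face σ 0) - boundaryPhase (face σ 1) + boundaryPhase (face σ 2))
    - (pathPhase (face σ 0) (faceDefect σ 0) - pathPhase (face σ 1) (faceDefect σ 1)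
      + pathPhase (face σ 2) (faceDefect σ 2))

/-- In bidegree `(2, 0)` integrality says that the cocycle is the group differential of the factors by
which the action changes the frames. -/
theorem coe_primitiveTwoZero (s : Splitting Γ) (g h : pointGroup Γ)
    (σ : Simplex 0 (ProductTorus Γ)) : (primitiveTwoZero s g h σ : Real.Angle) = 0 := by
  have h1 := pointPhase_add (translateSimplex (g * h) σ) (g • actionDefect s h σ)
    (actionDefect s g (translateSimplex h σ))
  rw [actionDefect_mul, pointPhase_add] at h1
  rw [translateSimplex_mul g h σ, pointPhase_translate g] at h1
  rw [primitiveTwoZero, coe_angle_pulledBackCocycle, actionPhase, actionPhase, actionPhase,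
    translateSimplex_mul g h σ]
  simp only [Real.Angle.coe_add, Real.Angle.coe_sub]
  linear_combination (norm := module) h1

/-- At each end of the path, the frame along `g σ` and the image of the frame at that end of `σ` are
compared in two ways, which agree modulo `2π`. -/
theorem coe_primitiveOneOne (s : Splitting Γ) (g : pointGroup Γ)
    (σ : Simplex 1 (ProductTorus Γ)) : (primitiveOneOne s g σ : Real.Angle) = 0 := by
  have key : ∀ i, (pointPhase (face (translateSimplex g σ) i) (actionDefect s g (face σ i)) :
      Real.Angle) +
        pointPhase (face (translateSimplex g σ) i) (faceDefect (translateSimplex g σ) i) =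
      pointPhase (face (translateSimplex g σ) i) (actionDefect s g σ) +
        pointPhase (face σ i) (faceDefect σ i) := fun i => by
    rw [← pointPhase_add, actionDefect_face, pointPhase_add, face_translateSimplex,
      pointPhase_translate]
  have h0 := key 0
  have h1 := key 1
  have h2 := coe_pathPhase (translateSimplex g σ) (actionDefect s g σ)
  rw [primitiveOneOne, boundaryPhase, boundaryPhase, actionPhase, actionPhase,
    ← face_translateSimplex, ← face_translateSimplex]
  simp only [Real.Angle.coe_sub]
  linear_combination (norm := module) h0 - h1 - h2

theorem coe_primitiveZeroTwo (σ : Simplex 2 (ProductTorus Γ)) :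
    (primitiveZeroTwo σ : Real.Angle) = 0 := by
  -- At each of the three vertices, two edges give the same total phase modulo `2π`.
  have key : ∀ i j : Fin 2, i ≤ j →
      (pointPhase (face (face σ j.succ) i) (faceDefect σ j.succ) : Real.Angle) +
        pointPhase (face (face σ j.succ) i) (faceDefect (face σ j.succ) i) =
      pointPhase (face (face σ i.castSucc) j) (faceDefect σ i.castSucc) +
        pointPhase (face (face σ i.castSucc) j) (faceDefect (face σ i.castSucc) j) := by
    intro i j hij
    rw [← pointPhase_add, ← pointPhase_add, faceDefect_face σ hij, face_face σ hij]
  have h00 := key 0 0 le_rfl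
  have h01 := key 0 1 zero_le_one
  have h11 := key 1 1 le_rfl
  have e1 : (Fin.succ 0 : Fin 3) = 1 := rfl
  have e2 : (Fin.succ 1 : Fin 3) = 2 := rfl
  have e3 : (Fin.castSucc 0 : Fin 3) = 0 := rfl
  have e4 : (Fin.castSucc 1 : Fin 3) = 1 := rfl
  simp only [e1, e2, e3, e4] at h00 h01 h11
  rw [primitiveZeroTwo, boundaryPhase, boundaryPhase, boundaryPhase]
  simp only [Real.Angle.coe_add, Real.Angle.coe_sub, Real.Angle.coe_neg, coe_pathPhase]
  linear_combination (norm := module) h00 - h01 + h11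

theorem pathPhase_actionDefect_boundary (s : Splitting Γ) (g : pointGroup Γ)
    (σ : Simplex 2 (ProductTorus Γ)) (i : Fin 3) :
    pathPhase (face (translateSimplex g σ) i) (actionDefect s g (face σ i)) +
        pathPhase (face (translateSimplex g σ) i) (faceDefect (translateSimplex g σ) i) =
      pathPhase (face (translateSimplex g σ) i) (actionDefect s g σ) +
        pathPhase (face σ i) (faceDefect σ i) := by
  rw [← pathPhase_add, actionDefect_face, pathPhase_add, face_translateSimplex, pathPhase_translate]

theorem pathPhase_faceDefect_face (σ : Simplex 3 (ProductTorus Γ)) {i j : Fin 3} (hij : i ≤ j) :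
    pathPhase (face (face σ j.succ) i) (faceDefect σ j.succ) +
        pathPhase (face (face σ j.succ) i) (faceDefect (face σ j.succ) i) =
      pathPhase (face (face σ i.castSucc) j) (faceDefect σ i.castSucc) +
        pathPhase (face (face σ i.castSucc) j) (faceDefect (face σ i.castSucc) j) := by
  rw [← pathPhase_add, ← pathPhase_add, faceDefect_face σ hij, face_face σ hij]

/-- The terms with `boundaryPhase` cancel by the simplicial identities. The others cancel in pairs up
to the boundaries of `pathPhase` over the four faces, which vanish. -/
theorem primitive_differential_zero_three (σ : Simplex 3 (ProductTorus Γ)) :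
    primitiveZeroTwo (face σ 0) - primitiveZeroTwo (face σ 1) + primitiveZeroTwo (face σ 2)
      - primitiveZeroTwo (face σ 3) = 0 := by
  have b00 := face_face σ (i := 0) (j := 0) le_rfl
  have b01 := face_face σ (i := 0) (j := 1) (by decide)
  have b02 := face_face σ (i := 0) (j := 2) (by decide)
  have b11 := face_face σ (i := 1) (j := 1) le_rfl
  have b12 := face_face σ (i := 1) (j := 2) (by decide)
  have b22 := face_face σ (i := 2) (j := 2) le_rfl
  have c00 := pathPhase_faceDefect_face σ (i := 0) (j := 0) le_rfl
  have c01 := pathPhase_faceDefect_face σ (i := 0) (j := 1) (by decide)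
  have c02 := pathPhase_faceDefect_face σ (i := 0) (j := 2) (by decide)
  have c11 := pathPhase_faceDefect_face σ (i := 1) (j := 1) le_rfl
  have c12 := pathPhase_faceDefect_face σ (i := 1) (j := 2) (by decide)
  have c22 := pathPhase_faceDefect_face σ (i := 2) (j := 2) le_rfl
  have t := fun i => pathPhase_boundary (face σ i) (faceDefect σ i)
  have t0 := t 0
  have t1 := t 1
  have t2 := t 2
  have t3 := t 3
  have e1 : (Fin.succ 0 : Fin 4) = 1 := rfl
  have e2 : (Fin.succ 1 : Fin 4) = 2 := rfl
  have e3 : (Fin.castSucc 0 : Fin 4) = 0 := rfl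
  have e4 : (Fin.castSucc 1 : Fin 4) = 1 := rfl
  have e5 : (Fin.succ 2 : Fin 4) = 3 := rfl
  have e6 : (Fin.castSucc 2 : Fin 4) = 2 := rfl
  simp only [e1, e2, e3, e4, e5, e6] at b00 b01 b02 b11 b12 b22 c00 c01 c02 c11 c12 c22
  simp only [b00, b01, b02, b11, b12, b22] at c00 c01 c02 c11 c12 c22 t0 t1 t2 t3
  simp only [primitiveZeroTwo, b00, b01, b02, b11, b12, b22]
  linear_combination c00 - c01 + c02 + c11 - c12 + c22 + t0 - t1 + t2 - t3

theorem primitive_differential_one_two (s : Splitting Γ) (g : pointGroup Γ)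
    (σ : Simplex 2 (ProductTorus Γ)) :
    primitiveZeroTwo σ - primitiveZeroTwo (translateSimplex g σ) =
      primitiveOneOne s g (face σ 0) - primitiveOneOne s g (face σ 1)
        + primitiveOneOne s g (face σ 2) := by
  have b00 := face_face σ (i := 0) (j := 0) le_rfl
  have b01 := face_face σ (i := 0) (j := 1) zero_le_one
  have b11 := face_face σ (i := 1) (j := 1) le_rfl
  have e1 : (Fin.succ 0 : Fin 3) = 1 := rfl
  have e2 : (Fin.succ 1 : Fin 3) = 2 := rfl
  have e3 : (Fin.castSucc 0 : Fin 3) = 0 := rfl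
  have e4 : (Fin.castSucc 1 : Fin 3) = 1 := rfl
  simp only [e1, e2, e3, e4] at b00 b01 b11
  have m := pathPhase_actionDefect_boundary s g σ
  have m0 := m 0
  have m1 := m 1
  have m2 := m 2
  have t := pathPhase_boundary (translateSimplex g σ) (actionDefect s g σ)
  simp only [face_translateSimplex] at m0 m1 m2 t
  simp only [primitiveZeroTwo, primitiveOneOne, face_translateSimplex, b00, b01, b11]
  linear_combination m0 - m1 + m2 + t

theorem primitive_differential_two_one (s : Splitting Γ) (g h : pointGroup Γ)
    (σ : Simplex 1 (ProductTorus Γ)) :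
    primitiveOneOne s h σ - primitiveOneOne s (g * h) σ + primitiveOneOne s g (translateSimplex h σ)
        + (primitiveTwoZero s g h (face σ 0) - primitiveTwoZero s g h (face σ 1)) =
      angle (pulledBackCocycle s) g h (σ (stdSimplex.vertex 1))
        - angle (pulledBackCocycle s) g h (σ (stdSimplex.vertex 0))
        - phaseVariation ((pulledBackCocycle s g h).comp σ) := by
  have h1 := congrArg (pathPhase (translateSimplex (g * h) σ)) (actionDefect_mul s g h σ)
  rw [pathPhase_add, pathPhase_add] at h1
  simp only [translateSimplex_mul, pathPhase_translate] at h1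
  rw [phaseVariation_pulledBackCocycle]
  simp only [primitiveOneOne, primitiveTwoZero, face_translateSimplex, face_vertex_zero,
    face_vertex_one, translateSimplex_mul]
  linear_combination -h1

theorem primitive_differential_three_zero (s : Splitting Γ) (g h k : pointGroup Γ)
    (σ : Simplex 0 (ProductTorus Γ)) :
    primitiveTwoZero s h k σ - primitiveTwoZero s (g * h) k σ + primitiveTwoZero s g (h * k) σ
        - primitiveTwoZero s g h (translateSimplex k σ) =
      angle (pulledBackCocycle s) h k (σ (stdSimplex.vertex 0))
        - angle (pulledBackCocycle s) (g * h) k (σ (stdSimplex.vertex 0))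
        + angle (pulledBackCocycle s) g (h * k) (σ (stdSimplex.vertex 0))
        - angle (pulledBackCocycle s) g h (k • σ (stdSimplex.vertex 0)) := by
  have e : translateSimplex k σ (stdSimplex.vertex 0) = k • σ (stdSimplex.vertex 0) := rfl
  simp only [primitiveTwoZero, translateSimplex_mul, mul_assoc, e]
  ring

/-- The integral cochain of total degree `2` whose differential is the twist cochain. The
rounded numbers are integers, see `coe_primitiveTwoZero`, `coe_primitiveOneOne` and
`coe_primitiveZeroTwo`. -/
def primitive (s : Splitting Γ) : Cochain (pointGroup Γ) (ProductTorus Γ)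
  | 2, 0 => fun g σ => round (primitiveTwoZero s (g 0) (g 1) σ / (2 * Real.pi))
  | 1, 1 => fun g σ => round (primitiveOneOne s (g 0) σ / (2 * Real.pi))
  | 0, 2 => fun _ σ => round (primitiveZeroTwo σ / (2 * Real.pi))
  | _, _ => 0

theorem primitive_zero_two (s : Splitting Γ) :
    primitive s 0 2 = fun _ σ => round (primitiveZeroTwo σ / (2 * Real.pi)) := rfl

theorem primitive_one_one (s : Splitting Γ) :
    primitive s 1 1 = fun g σ => round (primitiveOneOne s (g 0) σ / (2 * Real.pi)) := rfl

theorem primitive_mem_degreePart (s : Splitting Γ) :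
    primitive s ∈ degreePart (pointGroup Γ) (ProductTorus Γ) 2 := by
  intro p q h
  rw [primitive]
  all_goals
    rintro rfl rfl
    exact h rfl

theorem round_mul_two_pi {r : ℝ} (h : (r : Real.Angle) = 0) :
    (round (r / (2 * Real.pi)) : ℝ) * (2 * Real.pi) = r :=
  round_eq_of_exp (exp_eq_one_iff_coe_angle_eq_zero.2 h)

theorem int_eq_of_mul_two_pi {m n : ℤ} (h : (m : ℝ) * (2 * Real.pi) = n * (2 * Real.pi)) : m = n :=
  Int.cast_injective (mul_right_cancel₀ Real.two_pi_pos.ne' h)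

theorem totalD_primitive (s : Splitting Γ) :
    totalD (pointGroup Γ) (ProductTorus Γ) (primitive s) = twistCochain (pulledBackCocycle s) := by
  have hz := primitive_mem_degreePart s
  funext p q
  change groupPart _ _ (primitive s) p q + singPart _ _ (primitive s) p q = _
  have hgroup : p + q ≠ 3 ∨ p = 0 → groupPart _ _ (primitive s) p q = 0 := by
    rcases p with _ | p
    · exact fun _ => rfl
    · intro h
      rw [groupPart, hz p q (by omega), map_zero]
  have hsing : p + q ≠ 3 ∨ q = 0 → singPart _ _ (primitive s) p q = 0 := by
    rcases q with _ | q
    · exact fun _ => rfl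
    · intro h
      rw [singPart, hz p q (by omega), map_zero, mul_zero]
  by_cases hpq : p + q = 3
  swap
  · rw [hgroup (.inl hpq), hsing (.inl hpq), twistCochain_eq_zero _ (.inl hpq), add_zero]
  have hp : p ≤ 3 := by omega
  interval_cases p
  · obtain rfl : q = 3 := by omega
    rw [hgroup (.inr rfl), twistCochain_eq_zero _ (.inr (by omega)), zero_add]
    funext g σ
    have h : dSing _ _ 0 2 (primitive s 0 2) g σ = 0 := by
      apply int_eq_of_mul_two_pi
      rw [dSing_two]
      push_cast
      simp only [primitive, add_mul, sub_mul, round_mul_two_pi (coe_primitiveZeroTwo _),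
        primitive_differential_zero_three, zero_mul]
    change (-1) ^ 0 * _ = _
    rw [h, mul_zero]
    rfl
  · obtain rfl : q = 2 := by omega
    rw [twistCochain_eq_zero _ (.inr le_rfl)]
    funext g σ
    change dGroup _ _ 0 2 (primitive s 0 2) g σ + (-1) ^ 1 * dSing _ _ 1 1 (primitive s 1 1) g σ = 0
    apply int_eq_of_mul_two_pi
    rw [dSing_one, primitive_zero_two, dGroup_zero]
    push_cast
    simp only [primitive, add_mul, sub_mul, mul_assoc, round_mul_two_pi (coe_primitiveZeroTwo _),
      round_mul_two_pi (coe_primitiveOneOne _ _ _)]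
    rw [primitive_differential_one_two s (g 0) σ]
    ring
  · obtain rfl : q = 1 := by omega
    funext g σ
    change dGroup _ _ 1 1 (primitive s 1 1) g σ + (-1) ^ 2 * dSing _ _ 2 0 (primitive s 2 0) g σ = _
    apply int_eq_of_mul_two_pi
    rw [dSing_zero, primitive_one_one, dGroup_one (fun g σ =>
      round (primitiveOneOne s g σ / (2 * Real.pi))), twistCochain_21,
      ← primitive_differential_two_one]
    push_cast
    simp only [primitive, add_mul, sub_mul, mul_assoc, round_mul_two_pi (coe_primitiveOneOne _ _ _),
      round_mul_two_pi (coe_primitiveTwoZero _ _ _ _)]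
    ring
  · obtain rfl : q = 0 := by omega
    rw [hsing (.inr rfl), add_zero]
    funext g σ
    change dGroup _ _ 2 0 (primitive s 2 0) g σ = _
    apply int_eq_of_mul_two_pi
    rw [primitive, dGroup_two (fun g h σ =>
      round (primitiveTwoZero s g h σ / (2 * Real.pi))),
      twistCochain_30 (pulledBackCocycle_isCocycle s),
      ← primitive_differential_three_zero]
    push_cast
    simp only [add_mul, sub_mul, round_mul_two_pi (coe_primitiveTwoZero _ _ _ _)]

theorem twistClass_pulledBackCocycle_eq_zero (s : Splitting Γ) :
    twistClass (pulledBackCocycle s) (pulledBackCocycle_isCocycle s) = 0 :=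
  (QuotientAddGroup.eq_zero_iff _).2 <| AddSubgroup.mem_addSubgroupOf.2
    ⟨primitive s, primitive_mem_degreePart s, totalD_primitive s⟩

end Primitive

end CrystalTDuality

end

theorem corollary4p3 {d : ℕ} (Γ : Subgroup (EuclideanGroup d)) (hΓ : IsSpaceGroup Γ)
    (s : Splitting Γ) :
    IsTwistedEquivariantLineBundle (pulledBackCocycle s)
        (DualBundle.dualProj (PoincareBundle.proj (Γ := Γ))) (dualPoincareAction s) ∧
      twistClass (pulledBackCocycle s) (pulledBackCocycle_isCocycle s) = 0 := by
  have := hΓ.discrete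
  have := discreteTopology_lattice (Γ := Γ)
  exact ⟨isTwistedEquivariantLineBundle_dualPoincare s, twistClass_pulledBackCocycle_eq_zero s⟩
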